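/- Let $\mu$ be a probability measure on $\mathbb R^s$ and let $Y=(y^i)_{i\in\mathbb N}$ be an i.i.d. environment with law $\nu=\mu^{\otimes\mathbb N}$. Let $\varepsilon=(\varepsilon^i_t)_{i\in\mathbb N,\,t\in\mathbb Z}$ be real random variables on a probability space $(\Omega',\mathcal A',P')$, independent of $Y$, such that for each $i$ the sequence $(\varepsilon^i_t)_t$ is i.i.d. and for each $t$ the sequence $(\varepsilon^i_t)_i$ is stationary (dependence between different $i$ is allowed). For jointly measurable functions $Z_t:\mathbb R^s\times\mathbb R^{\mathbb Z}\to\mathbb R$ ($t\in\mathbb Z$) put $Z^i_t=Z_t(y^i,\varepsilon^i)$, where $\varepsilon^i=(\varepsilon^i_t)_{t\in\mathbb Z}$, and $$X^N_t(Y)=\frac1{\sqrt N}\sum_{i=1}^N Z^i_t .$$ Write $\mathbb E^Y$ and $\mathrm{cov}^Y$ for expectation and covariance with respect to $P'$ with the environment $Y$ held fixed, and $\mathbb E^{y}$ when the parameter $y^i=y$ is held fixed. Assume the following. * (Centering) $\mathbb E^{y^i}[Z^i_t]=0$ for $\mu$-a.e. $y^i$, for all $i,t$. * (K$2_\delta$)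 $\delta>0$ and $\mathbb E\big[|Z^i_t|^{2+\delta}\big]<\infty$ for all $i,t$. * (K4) There is a function $\Gamma:\mathbb Z\to\mathbb R$ such that for all $t,\tau\in\mathbb Z$, for $\nu$-a.e. $Y$, $\mathrm{cov}^Y\big(X^N_t(Y),X^N_{t+\tau}(Y)\big)\to\Gamma(\tau)$ as $N\to\infty$. * ($(\lambda,Y)$-weak dependence and K5) There are a measurable $V:\mathbb R^s\to[0,\infty)$ with $\int V\,d\mu<\infty$ and $\mathbb E^{y^i}[|Z^i_t|^2]\le V(y^i)^2$ for $\mu$-a.e. $y^i$ and all $i,t$, and, for $\nu$-a.e. $Y$, a sequence $\lambda(r)=\lambda_Y(r)$ decreasing to $0$ as $r\to\infty$ such that $$\Big|\mathrm{cov}^Y\big(f(Z^{i_1}_{t_1},\dots,Z^{i_u}_{t_u}),\,g(Z^{j_1}_{t'_1},\dots,Z^{j_v}_{t'_v})\big)\Big|\le\big(\mathrm{Lip}(f)\,d_{\mathbf i}+\mathrm{Lip}(g)\,d_{\mathbf j}+\mathrm{Lip}(f)\mathrm{Lip}(g)\,d_{\mathbf i}d_{\mathbf j}\big)\,\lambda(r)$$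 for all $r\ge0$, all $u,v$, all times $t_m,t'_m\in\mathbb Z$, all indices $i_1\le\dots\le i_u\le i_u+r<j_1\le\dots\le j_v$, and all $f:\mathbb R^u\to\mathbb R$, $g:\mathbb R^v\to\mathbb R$ bounded by $1$ in absolute value and Lipschitz for the $\ell^1$ distance, with least Lipschitz constants $\mathrm{Lip}(f),\mathrm{Lip}(g)$; here $d_{\mathbf i}=\sum_{m=1}^uV(y^{i_m})$ and $d_{\mathbf j}=\sum_{m=1}^vV(y^{j_m})$. * (Rate) For some $\ell>2+3/\delta$, $\lambda_Y(r)=O(r^{-\ell})$ as $r\to\infty$, for $\nu$-a.e. $Y$. Then there is a centered Gaussian process $X=(X_t)_{t\in\mathbb Z}$ with covariance $\mathrm{cov}(X_t,X_{t+\tau})=\Gamma(\tau)$ for all $t,\tau$, such that for $\nu$-almost every environment $Y$ the process $X^N(Y)$ converges to $X$ in distribution under $P'$, in the sense of finite-dimensional distributions. -/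

import Mathlib

open MeasureTheory ProbabilityTheory Filter Topology Asymptotics

namespace DoublyStochastic

noncomputable section

/-- The array of innovations `ε i t` (individual `i`, time `t`): for each individual `i` the
sequence `(ε i t)` over `t : ℤ` is i.i.d. (a strong white noise), and for each time `t` the sequence
`(ε i t)` over `i` is stationary. Dependence between different individuals is allowed. -/
structure IsInnovationArray {Ω' : Type*} [MeasurableSpace Ω'] (P' : Measure Ω')
    (ε : ℕ → ℤ → Ω' → ℝ) : Prop where
  measurable : ∀ i t, Measurable (ε i t)
  indep : ∀ i, iIndepFun (ε i) P'
  identDistrib : ∀ i t t', IdentDistrib (ε i t) (ε i t') P' P'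
  stationary : ∀ t, P'.map (fun ω i => ε (i + 1) t ω) = P'.map (fun ω i => ε i t ω)

/-- The law `ν` of the random environment `Y = (y i)`: the `y i` are i.i.d. with law `μ`. -/
def envLaw {s : ℕ} (μ : Measure (Fin s → ℝ)) : Measure (ℕ → Fin s → ℝ) :=
  Measure.infinitePi fun _ => μ

/-- The elementary process of individual `i` at time `t` with parameter `y`:
`Z t (y, ε i)`, a random variable on the innovation space `Ω'`. -/
def elem {s : ℕ} {Ω' : Type*} (Z : ℤ → (Fin s → ℝ) → (ℤ → ℝ) → ℝ) (ε : ℕ → ℤ → Ω' → ℝ)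
    (i : ℕ) (t : ℤ) (y : Fin s → ℝ) (ω : Ω') : ℝ :=
  Z t y (fun k => ε i k ω)

/-- The partial aggregation `X^N_t(Y) = N^{-1/2} ∑_{i=1}^N Z t (Y i, ε i)` in environment `Y`. -/
def aggregation {s : ℕ} {Ω' : Type*} (Z : ℤ → (Fin s → ℝ) → (ℤ → ℝ) → ℝ)
    (ε : ℕ → ℤ → Ω' → ℝ) (Y : ℕ → Fin s → ℝ) (N : ℕ) (t : ℤ) (ω : Ω') : ℝ :=
  (Real.sqrt N)⁻¹ * ∑ i ∈ Finset.Icc 1 N, elem Z ε i t (Y i) ω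

/-- `L` is a Lipschitz constant of `f` for the `ℓ¹` distance. -/
def HasLipConst {k : ℕ} (f : (Fin k → ℝ) → ℝ) (L : ℝ) : Prop :=
  0 ≤ L ∧ ∀ z z' : Fin k → ℝ, |f z - f z'| ≤ L * ∑ m, |z m - z' m|

/-- The (least) Lipschitz constant of `f` for the `ℓ¹` distance. -/
def lip {k : ℕ} (f : (Fin k → ℝ) → ℝ) : ℝ := sInf {L | HasLipConst f L}

/-- The class of Lipschitz functions on `ℝ^k` bounded by one. -/
def Delta1 (k : ℕ) : Set ((Fin k → ℝ) → ℝ) :=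
  {f | (∃ L, HasLipConst f L) ∧ ∀ z, |f z| ≤ 1}

/-- `(epsilon, ψ, Y)`-weak dependence of the sequence of doubly stochastic processes, with control
function `V` and coefficients `c Y r`. The covariance is computed on the innovation space with
the environment `Y` frozen. The individuals `i 0 ≤ … ≤ i (u-1)` (and likewise `j`) need not be
distinct, so that one individual may be observed at several times. -/
structure IsWeaklyDependent {s : ℕ} {Ω' : Type*} [MeasurableSpace Ω'] (P' : Measure Ω')
    (μ : Measure (Fin s → ℝ)) (Z : ℤ → (Fin s → ℝ) → (ℤ → ℝ) → ℝ) (ε : ℕ → ℤ → Ω' → ℝ)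
    (ψ : ℝ → ℝ → ℝ → ℝ → ℝ) (V : (Fin s → ℝ) → ℝ) (c : (ℕ → Fin s → ℝ) → ℕ → ℝ) : Prop where
  measurable_V : Measurable V
  V_nonneg : ∀ y, 0 ≤ V y
  moment_le : ∀ i t, ∀ᵐ y ∂μ,
    ∫⁻ ω, ENNReal.ofReal (elem Z ε i t y ω ^ 2) ∂P' ≤ ENNReal.ofReal (V y ^ 2)
  coeff_antitone : ∀ᵐ Y ∂(envLaw μ), Antitone (c Y)
  coeff_tendsto : ∀ᵐ Y ∂(envLaw μ), Tendsto (c Y) atTop (𝓝 0)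
  cov_le : ∀ᵐ Y ∂(envLaw μ), ∀ (r u v : ℕ) (i : Fin u → ℕ) (j : Fin v → ℕ)
    (t : Fin u → ℤ) (t' : Fin v → ℤ), Monotone i → Monotone j → (∀ a b, i a + r < j b) →
    ∀ f ∈ Delta1 u, ∀ g ∈ Delta1 v,
      |cov[fun ω => f (fun m => elem Z ε (i m) (t m) (Y (i m)) ω),
          fun ω => g (fun m => elem Z ε (j m) (t' m) (Y (j m)) ω); P']| ≤
        ψ (∑ m, V (Y (i m))) (∑ m, V (Y (j m))) (lip f) (lip g) * c Y r

/-- The function `ψ` of `λ`-weak dependence. -/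
def lambdaPsi (u v a b : ℝ) : ℝ := a * u + b * v + a * b * u * v

/-- `(λ, Y)`-weak dependence with control function `V` and coefficients `lam Y r`. -/
def IsLambdaWeaklyDependent {s : ℕ} {Ω' : Type*} [MeasurableSpace Ω'] (P' : Measure Ω')
    (μ : Measure (Fin s → ℝ)) (Z : ℤ → (Fin s → ℝ) → (ℤ → ℝ) → ℝ) (ε : ℕ → ℤ → Ω' → ℝ)
    (V : (Fin s → ℝ) → ℝ) (lam : (ℕ → Fin s → ℝ) → ℕ → ℝ) : Prop :=
  IsWeaklyDependent P' μ Z ε lambdaPsi V lam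

end

end DoublyStochastic

/-!
In almost every fixed environment the summands are centered, have moments of order `2 + δ`, and are
weakly dependent, so the result is a central limit theorem for a nonstationary sequence, combined
with the law of large numbers for the environment.

**Fixed environment.** For `a : ℤ → ℝ` and a finite set `I` of times, let
`W i = ∑ t ∈ I, a t * Z t (Y i, ε i)`. The dependence enters through `IsBlockWeaklyDependent`, a
bound for the covariances of Lipschitz functions of two block sums of `W` in terms of a control
sequence `A`, which dominates `V (Y i)` and the moments of order `2 + δ`. Bernstein's method cuts
`{0, …, N - 1}` into blocks of length `p` separated by gaps of length `q`
(`tendsto_integral_exp_of_blocks`): the sum over the gaps is negligible in `L²`, the characteristic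
function of the sum over the blocks nearly factorizes by weak dependence, and the product over the
blocks converges by Lyapunov's condition (`tendsto_prod_integral_exp`). With `p ≈ N ^ a`, `q ≈ N ^ b`
this requires `b < a < δ / (2 (1 + δ))` and `ℓ b + a > 3 / 2`, which is possible exactly when
`ℓ > 2 + 3 / δ` (`exists_block_exponents`).

**Covariances.** The control function `V` is only integrable, so bounds involving the products
`V (Y i) * V (Y j)` could not be averaged over the environment. Interpolating the weak dependence
bound of truncated variables with the trivial one replaces the coefficient by its square root and
makes the bound linear: `|E W i W j| ≤ (A i + A j) ρ (|i - j|)` with `ρ` summable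
(`IsBlockWeaklyDependent.abs_integral_mul_le_rpow`). The covariances of pairs of indices which are
not in the same block are then estimated by averages of `A` with bounded weights of vanishing mean.
Such averages vanish in almost every environment (`ae_hasUniformAverages`), by the strong law of
large numbers for `A` and for its truncations. The convergence of the covariance functions
identifies the limiting variance as `covForm Γ I a`.

**Limit process.** In any one of these environments the laws of the aggregations on `ℤ → ℝ` are
tight. By Prokhorov's theorem they have a limit point, whose characteristic functions are the
Gaussian ones (`exists_hasGaussianCharFun`): this is the law of `X`, and it does not depend on the
environment. Convergence of the finite-dimensional distributions is Lévy's theorem.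
-/

namespace DoublyStochastic

/-! ### Moments -/

lemma sq_le_one_add_rpow {δ : ℝ} (hδ : 0 < δ) (x : ℝ) : x ^ 2 ≤ 1 + |x| ^ (2 + δ) := by
  have h0 : 0 ≤ |x| ^ (2 + δ) := Real.rpow_nonneg (abs_nonneg x) _
  rcases le_total |x| 1 with h | h
  · have : x ^ 2 ≤ 1 := by rw [← sq_abs]; exact pow_le_one₀ (abs_nonneg x) h
    linarith
  · have : |x| ^ (2 : ℝ) ≤ |x| ^ (2 + δ) := Real.rpow_le_rpow_of_exponent_le h (by linarith)
    rw [Real.rpow_two, sq_abs] at this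
    linarith

lemma abs_le_one_add_rpow {δ : ℝ} (hδ : 0 < δ) (x : ℝ) : |x| ≤ 1 + |x| ^ (2 + δ) := by
  have h0 : 0 ≤ |x| ^ (2 + δ) := Real.rpow_nonneg (abs_nonneg x) _
  rcases le_total |x| 1 with h | h
  · linarith
  · have : |x| ^ (1 : ℝ) ≤ |x| ^ (2 + δ) := Real.rpow_le_rpow_of_exponent_le h (by linarith)
    rw [Real.rpow_one] at this
    linarith

/-- Beyond the level `η` a square is dominated by the moment of order `2 + δ`. -/
lemma sq_le_rpow_mul_of_le_abs {δ η x : ℝ} (hδ : 0 < δ) (hη : 0 < η) (hx : η ≤ |x|) :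
    x ^ 2 ≤ η ^ (-δ) * |x| ^ (2 + δ) := by
  have hx0 : 0 < |x| := hη.trans_le hx
  rw [Real.rpow_add hx0, Real.rpow_two, sq_abs, Real.rpow_neg hη.le]
  have h1 : η ^ δ ≤ |x| ^ δ := Real.rpow_le_rpow hη.le hx hδ.le
  have h2 : 0 < η ^ δ := Real.rpow_pos_of_pos hη δ
  have h3 : 1 ≤ (η ^ δ)⁻¹ * |x| ^ δ := by
    rw [inv_mul_eq_div, le_div_iff₀ h2]; linarith
  nlinarith [sq_nonneg x]

section Integrability

variable {Ω : Type*} [MeasurableSpace Ω] {P : Measure Ω} [IsProbabilityMeasure P]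

lemma integrable_of_integrable_rpow {δ : ℝ} (hδ : 0 < δ) {X : Ω → ℝ} (hX : Measurable X)
    (h : Integrable (fun ω => |X ω| ^ (2 + δ)) P) : Integrable X P := by
  refine Integrable.mono' ((integrable_const (1 : ℝ)).add h) hX.aestronglyMeasurable ?_
  exact Eventually.of_forall fun ω => by simpa using abs_le_one_add_rpow hδ (X ω)

lemma integrable_sq_of_integrable_rpow {δ : ℝ} (hδ : 0 < δ) {X : Ω → ℝ} (hX : Measurable X)
    (h : Integrable (fun ω => |X ω| ^ (2 + δ)) P) : Integrable (fun ω => X ω ^ 2) P := by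
  refine Integrable.mono' ((integrable_const (1 : ℝ)).add h)
    (hX.pow_const 2).aestronglyMeasurable ?_
  exact Eventually.of_forall fun ω => by
    simpa [abs_of_nonneg (sq_nonneg (X ω))] using sq_le_one_add_rpow hδ (X ω)

lemma memLp_two_of_integrable_rpow {δ : ℝ} (hδ : 0 < δ) {X : Ω → ℝ} (hX : Measurable X)
    (h : Integrable (fun ω => |X ω| ^ (2 + δ)) P) : MemLp X 2 P :=
  (memLp_two_iff_integrable_sq hX.aestronglyMeasurable).2
    (integrable_sq_of_integrable_rpow hδ hX h)

lemma integral_sq_le_of_integral_rpow {δ : ℝ} (hδ : 0 < δ) {X : Ω → ℝ} (hX : Measurable X)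
    (h : Integrable (fun ω => |X ω| ^ (2 + δ)) P) :
    ∫ ω, X ω ^ 2 ∂P ≤ 1 + ∫ ω, |X ω| ^ (2 + δ) ∂P := by
  have := integral_mono (integrable_sq_of_integrable_rpow hδ hX h)
    ((integrable_const (1 : ℝ)).add h) (fun ω => sq_le_one_add_rpow hδ (X ω))
  simpa [integral_add (integrable_const (1 : ℝ)) h] using this

end Integrability

/-! ### Products of characteristic functions of a triangular array -/

lemma norm_exp_sub_taylor_le (x : ℝ) :
    ‖Complex.exp (x * Complex.I) - (1 + x * Complex.I - x ^ 2 / 2)‖ ≤ 4 * (x ^ 2 * min 1 |x|) := by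
  rcases le_total |x| 1 with h | h
  · rw [min_eq_right h]
    have hn : ‖(x * Complex.I : ℂ)‖ = |x| := by simp
    have := Complex.exp_bound (x := x * Complex.I) (by rw [hn]; exact h) (n := 3) (by norm_num)
    rw [hn] at this
    have he : ∑ m ∈ Finset.range 3, (x * Complex.I : ℂ) ^ m / (m.factorial : ℂ) =
        1 + x * Complex.I - x ^ 2 / 2 := by
      simp [Finset.sum_range_succ, mul_pow, Complex.I_sq]; ring
    rw [he] at this
    refine this.trans ?_
    have : |x| ^ 3 = x ^ 2 * |x| := by rw [pow_succ, sq_abs]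
    rw [this]
    norm_num [Nat.factorial]
    nlinarith [mul_nonneg (sq_nonneg x) (abs_nonneg x)]
  · rw [min_eq_left h]
    have h1 : ‖Complex.exp (x * Complex.I)‖ = 1 := Complex.norm_exp_ofReal_mul_I x
    have h2 : ‖(1 + x * Complex.I - x ^ 2 / 2 : ℂ)‖ ≤ 1 + |x| + x ^ 2 / 2 := by
      refine (norm_sub_le _ _).trans (add_le_add ((norm_add_le _ _).trans ?_) ?_)
      · simp
      · simp [sq_abs]
    have h3 : 1 ≤ x ^ 2 := by rw [← sq_abs]; exact one_le_pow₀ h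
    have h4 : |x| ≤ x ^ 2 := by rw [← sq_abs]; nlinarith
    refine (norm_sub_le _ _).trans ?_
    linarith

lemma sq_mul_min_le {δ η : ℝ} (hδ : 0 < δ) (hη : 0 < η) (x : ℝ) :
    x ^ 2 * min 1 |x| ≤ η * x ^ 2 + η ^ (-δ) * |x| ^ (2 + δ) := by
  have h0 : 0 ≤ η ^ (-δ) * |x| ^ (2 + δ) :=
    mul_nonneg (Real.rpow_nonneg hη.le _) (Real.rpow_nonneg (abs_nonneg x) _)
  rcases le_total η |x| with h | h
  · have h1 := sq_le_rpow_mul_of_le_abs hδ hη h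
    have h2 : min 1 |x| ≤ 1 := min_le_left _ _
    nlinarith [sq_nonneg x]
  · have h2 : min 1 |x| ≤ η := (min_le_right _ _).trans h
    nlinarith [sq_nonneg x]

section

variable {Ω : Type*} [MeasurableSpace Ω] {P : Measure Ω} [IsProbabilityMeasure P]

lemma integrable_exp_ofReal_mul_I {X : Ω → ℝ} (hX : Measurable X) :
    Integrable (fun ω => Complex.exp (X ω * Complex.I)) P := by
  refine Integrable.of_bound (C := 1) ?_ (Eventually.of_forall fun ω => ?_)
  · exact (Measurable.cexp (by fun_prop)).aestronglyMeasurable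
  · rw [Complex.norm_exp_ofReal_mul_I]

lemma norm_integral_exp_le_one (X : Ω → ℝ) :
    ‖∫ ω, Complex.exp (X ω * Complex.I) ∂P‖ ≤ 1 := by
  refine (norm_integral_le_integral_norm _).trans ?_
  simp [Complex.norm_exp_ofReal_mul_I]

lemma norm_integral_exp_sub_le {δ η : ℝ} (hδ : 0 < δ) (hη : 0 < η) {X : Ω → ℝ}
    (hX : Measurable X) (h : Integrable (fun ω => |X ω| ^ (2 + δ)) P) (h0 : ∫ ω, X ω ∂P = 0) :
    ‖∫ ω, Complex.exp (X ω * Complex.I) ∂P - (1 - (∫ ω, X ω ^ 2 ∂P : ℝ) / 2)‖ ≤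
      4 * (η * ∫ ω, X ω ^ 2 ∂P + η ^ (-δ) * ∫ ω, |X ω| ^ (2 + δ) ∂P) := by
  have i1 := integrable_of_integrable_rpow hδ hX h
  have i2 := integrable_sq_of_integrable_rpow hδ hX h
  have i1c : Integrable (fun ω => (X ω : ℂ)) P := i1.ofReal
  have i2c : Integrable (fun ω => ((X ω ^ 2 : ℝ) : ℂ)) P := i2.ofReal
  have i3 : Integrable (fun ω => (1 + X ω * Complex.I - ((X ω ^ 2 : ℝ) : ℂ) / 2 : ℂ)) P :=
    ((integrable_const _).add (i1c.mul_const _)).sub (i2c.div_const _)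
  have e : ∫ ω, (1 + X ω * Complex.I - ((X ω ^ 2 : ℝ) : ℂ) / 2 : ℂ) ∂P =
      1 - (∫ ω, X ω ^ 2 ∂P : ℝ) / 2 := by
    have ia : Integrable (fun ω => (1 + X ω * Complex.I : ℂ)) P :=
      (integrable_const _).add (i1c.mul_const _)
    rw [integral_sub ia (i2c.div_const 2), integral_add (integrable_const (1 : ℂ))
      (i1c.mul_const Complex.I), integral_mul_const, integral_div,
      integral_complex_ofReal,
      integral_complex_ofReal, h0]
    simp
  rw [← e, ← integral_sub (integrable_exp_ofReal_mul_I hX) i3]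
  refine (norm_integral_le_integral_norm _).trans ?_
  have : 4 * (η * ∫ ω, X ω ^ 2 ∂P + η ^ (-δ) * ∫ ω, |X ω| ^ (2 + δ) ∂P) =
      ∫ ω, 4 * (η * X ω ^ 2 + η ^ (-δ) * |X ω| ^ (2 + δ)) ∂P := by
    rw [integral_const_mul, integral_add (i2.const_mul _) (h.const_mul _), integral_const_mul,
      integral_const_mul]
  rw [this]
  refine integral_mono ((integrable_exp_ofReal_mul_I hX).sub i3).norm
    (((i2.const_mul _).add (h.const_mul _)).const_mul _) fun ω => ?_
  have h1 := norm_exp_sub_taylor_le (X ω)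
  have h2 := sq_mul_min_le hδ hη (X ω)
  push_cast
  linarith

end

/-- A product of numbers of the closed unit disc is a `1`-Lipschitz function of its factors. -/
lemma norm_prod_sub_prod_le_sum {ι : Type*} (s : Finset ι) (a b : ι → ℂ)
    (ha : ∀ i ∈ s, ‖a i‖ ≤ 1) (hb : ∀ i ∈ s, ‖b i‖ ≤ 1) :
    ‖∏ i ∈ s, a i - ∏ i ∈ s, b i‖ ≤ ∑ i ∈ s, ‖a i - b i‖ := by
  classical
  induction s using Finset.induction_on with
  | empty => simp
  | insert i s hi ih =>
    rw [Finset.prod_insert hi, Finset.prod_insert hi, Finset.sum_insert hi]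
    have e : a i * ∏ i ∈ s, a i - b i * ∏ i ∈ s, b i =
        (a i - b i) * ∏ i ∈ s, a i + b i * (∏ i ∈ s, a i - ∏ i ∈ s, b i) := by ring
    rw [e]
    refine (norm_add_le _ _).trans (add_le_add ?_ ?_)
    · rw [norm_mul]
      refine mul_le_of_le_one_right (norm_nonneg _) ?_
      rw [norm_prod]
      exact Finset.prod_le_one (fun _ _ => norm_nonneg _)
        fun j hj => ha j (Finset.mem_insert_of_mem hj)
    · rw [norm_mul]
      refine (mul_le_of_le_one_left (norm_nonneg _) (hb i (Finset.mem_insert_self _ _))).trans ?_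
      exact ih (fun j hj => ha j (Finset.mem_insert_of_mem hj))
        fun j hj => hb j (Finset.mem_insert_of_mem hj)

lemma norm_one_sub_sub_exp_le {v : ℝ} (hv : 0 ≤ v) :
    ‖((1 - (v : ℂ) / 2) - Complex.exp (-(v : ℂ) / 2))‖ ≤ v ^ 2 := by
  have e : ((1 - (v : ℂ) / 2) - Complex.exp (-(v : ℂ) / 2)) =
      ((1 - v / 2 - Real.exp (-v / 2) : ℝ) : ℂ) := by push_cast; rfl
  rw [e, Complex.norm_real, Real.norm_eq_abs, abs_le]
  have h1 : -v / 2 + 1 ≤ Real.exp (-v / 2) := Real.add_one_le_exp _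
  have h2 : Real.exp (-v / 2) ≤ 1 := Real.exp_le_one_iff.2 (by linarith)
  constructor
  · rcases le_total v 1 with h | h
    · have := Real.abs_exp_sub_one_sub_id_le (x := -v / 2) (by rw [abs_le]; constructor <;> linarith)
      have := (abs_le.1 this).2
      nlinarith
    · nlinarith
  · nlinarith

/-- Lyapunov's central limit theorem, stated for the products of the characteristic functions of
the rows of a triangular array: no joint law is involved. -/
lemma tendsto_prod_integral_exp {Ω : Type*} [MeasurableSpace Ω] {P : Measure Ω}
    [IsProbabilityMeasure P] {δ : ℝ} (hδ : 0 < δ) (k : ℕ → ℕ) (X : ℕ → ℕ → Ω → ℝ)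
    (hX : ∀ N j, Measurable (X N j)) (hint : ∀ N j, Integrable (fun ω => |X N j ω| ^ (2 + δ)) P)
    (h0 : ∀ N j, ∫ ω, X N j ω ∂P = 0) {v : ℝ}
    (hv : Tendsto (fun N => ∑ j ∈ Finset.range (k N), ∫ ω, X N j ω ^ 2 ∂P) atTop (𝓝 v))
    (hL : Tendsto (fun N => ∑ j ∈ Finset.range (k N), ∫ ω, |X N j ω| ^ (2 + δ) ∂P) atTop (𝓝 0)) :
    Tendsto (fun N => ∏ j ∈ Finset.range (k N), ∫ ω, Complex.exp (X N j ω * Complex.I) ∂P)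
      atTop (𝓝 (Complex.exp (-(v : ℂ) / 2))) := by
  set V : ℕ → ℝ := fun N => ∑ j ∈ Finset.range (k N), ∫ ω, X N j ω ^ 2 ∂P with hV
  set L : ℕ → ℝ := fun N => ∑ j ∈ Finset.range (k N), ∫ ω, |X N j ω| ^ (2 + δ) ∂P with hLdef
  have hv0 : ∀ N j, 0 ≤ ∫ ω, X N j ω ^ 2 ∂P := fun N j => integral_nonneg fun ω => sq_nonneg _
  have hl0 : ∀ N j, 0 ≤ ∫ ω, |X N j ω| ^ (2 + δ) ∂P :=
    fun N j => integral_nonneg fun ω => Real.rpow_nonneg (abs_nonneg _) _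
  have hexp : Tendsto (fun N => Complex.exp (-(V N : ℂ) / 2)) atTop
      (𝓝 (Complex.exp (-(v : ℂ) / 2))) := by
    have hc : Continuous fun x : ℝ => Complex.exp (-(x : ℂ) / 2) := by fun_prop
    exact (hc.tendsto v).comp hv
  -- the total error of the second order expansions, at an arbitrary level `η`
  have key : ∀ η : ℝ, 0 < η → ∀ N,
      ‖∏ j ∈ Finset.range (k N), ∫ ω, Complex.exp (X N j ω * Complex.I) ∂P -
        Complex.exp (-(V N : ℂ) / 2)‖ ≤
      4 * (η * V N + η ^ (-δ) * L N) + (η ^ 2 + η ^ (-δ) * L N) * V N := by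
    intro η hη N
    have e : Complex.exp (-(V N : ℂ) / 2) =
        ∏ j ∈ Finset.range (k N), Complex.exp (-((∫ ω, X N j ω ^ 2 ∂P : ℝ) : ℂ) / 2) := by
      rw [← Complex.exp_sum, hV]
      congr 1
      push_cast
      rw [← Finset.sum_div, Finset.sum_neg_distrib]
    rw [e]
    refine (norm_prod_sub_prod_le_sum _ _ _ (fun j _ => norm_integral_exp_le_one _)
      fun j _ => ?_).trans ?_
    · have e' : (-((∫ ω, X N j ω ^ 2 ∂P : ℝ) : ℂ) / 2) =
        ((-(∫ ω, X N j ω ^ 2 ∂P) / 2 : ℝ) : ℂ) := by push_cast; ring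
      rw [e', ← Complex.ofReal_exp, Complex.norm_real, Real.norm_eq_abs, Real.abs_exp]
      exact Real.exp_le_one_iff.2 (by linarith [hv0 N j])
    have hvj : ∀ j ∈ Finset.range (k N), ∫ ω, X N j ω ^ 2 ∂P ≤ η ^ 2 + η ^ (-δ) * L N := by
      intro j hj
      have h1 : ∫ ω, X N j ω ^ 2 ∂P ≤ η ^ 2 + η ^ (-δ) * ∫ ω, |X N j ω| ^ (2 + δ) ∂P := by
        have := integral_mono (integrable_sq_of_integrable_rpow hδ (hX N j) (hint N j))
          ((integrable_const (η ^ 2)).add ((hint N j).const_mul (η ^ (-δ)))) (fun ω => by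
            have h0 : 0 ≤ η ^ (-δ) * |X N j ω| ^ (2 + δ) :=
              mul_nonneg (Real.rpow_nonneg hη.le _) (Real.rpow_nonneg (abs_nonneg _) _)
            change X N j ω ^ 2 ≤ η ^ 2 + η ^ (-δ) * |X N j ω| ^ (2 + δ)
            rcases le_total η |X N j ω| with h | h
            · have := sq_le_rpow_mul_of_le_abs hδ hη h
              nlinarith
            · have : X N j ω ^ 2 ≤ η ^ 2 := by
                rw [← sq_abs]; exact pow_le_pow_left₀ (abs_nonneg _) h 2
              linarith)
        simpa [integral_add (integrable_const _) ((hint N j).const_mul (η ^ (-δ))),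
          integral_const_mul] using this
      have h2 : ∫ ω, |X N j ω| ^ (2 + δ) ∂P ≤ L N :=
        Finset.single_le_sum (f := fun j => ∫ ω, |X N j ω| ^ (2 + δ) ∂P)
          (fun i _ => hl0 N i) hj
      have := mul_le_mul_of_nonneg_left h2 (Real.rpow_nonneg hη.le (-δ))
      linarith
    have hterm : ∀ j ∈ Finset.range (k N),
        ‖∫ ω, Complex.exp (X N j ω * Complex.I) ∂P -
          Complex.exp (-((∫ ω, X N j ω ^ 2 ∂P : ℝ) : ℂ) / 2)‖ ≤
        4 * (η * ∫ ω, X N j ω ^ 2 ∂P + η ^ (-δ) * ∫ ω, |X N j ω| ^ (2 + δ) ∂P) +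
          (η ^ 2 + η ^ (-δ) * L N) * ∫ ω, X N j ω ^ 2 ∂P := by
      intro j hj
      have h1 := norm_integral_exp_sub_le hδ hη (hX N j) (hint N j) (h0 N j)
      have h2 := norm_one_sub_sub_exp_le (hv0 N j)
      refine (norm_sub_le_norm_sub_add_norm_sub _ _ _).trans (add_le_add h1 (h2.trans ?_))
      rw [sq]
      exact mul_le_mul_of_nonneg_right (hvj j hj) (hv0 N j)
    refine (Finset.sum_le_sum hterm).trans (le_of_eq ?_)
    rw [Finset.sum_add_distrib, ← Finset.mul_sum, ← Finset.mul_sum, Finset.sum_add_distrib,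
      ← Finset.mul_sum, ← Finset.mul_sum]
  have hdiff : Tendsto (fun N => ∏ j ∈ Finset.range (k N),
      ∫ ω, Complex.exp (X N j ω * Complex.I) ∂P - Complex.exp (-(V N : ℂ) / 2)) atTop (𝓝 0) := by
    rw [Metric.tendsto_nhds]
    intro e he
    have hlim : Tendsto (fun η : ℝ => 4 * (η * v) + η ^ 2 * v) (𝓝[>] 0) (𝓝 0) := by
      have : Continuous fun η : ℝ => 4 * (η * v) + η ^ 2 * v := by fun_prop
      simpa using (this.tendsto 0).mono_left nhdsWithin_le_nhds
    obtain ⟨η, hηe, hη⟩ := ((hlim.eventually (gt_mem_nhds he)).and self_mem_nhdsWithin).exists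
    have hlim2 : Tendsto (fun N => 4 * (η * V N + η ^ (-δ) * L N) +
        (η ^ 2 + η ^ (-δ) * L N) * V N) atTop (𝓝 (4 * (η * v + η ^ (-δ) * 0) +
        (η ^ 2 + η ^ (-δ) * 0) * v)) :=
      (((hv.const_mul _).add (hL.const_mul _)).const_mul _).add
        ((tendsto_const_nhds.add (hL.const_mul _)).mul hv)
    have hlt : 4 * (η * v + η ^ (-δ) * 0) + (η ^ 2 + η ^ (-δ) * 0) * v < e := by
      simpa using hηe
    filter_upwards [hlim2.eventually (gt_mem_nhds hlt)] with N hN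
    rw [dist_zero_right]
    exact (key η hη N).trans_lt hN
  simpa using hdiff.add hexp

/-! ### Weak dependence of block sums -/

section

variable {Ω : Type*} [MeasurableSpace Ω] {P : Measure Ω} [IsProbabilityMeasure P]

/-- Weak dependence of a real sequence `W`, tested only on functions of partial sums over two
separated blocks of indices: `A` is the control sequence and `lam` the decay of the coefficients. -/
def IsBlockWeaklyDependent (P : Measure Ω) (W : ℕ → Ω → ℝ) (A : ℕ → ℝ) (lam : ℕ → ℝ) : Prop :=
  ∀ (r : ℕ) (B B' : Finset ℕ), (∀ b ∈ B, ∀ b' ∈ B', b + r < b') →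
    ∀ (f g : ℝ → ℝ) (K K' : ℝ), (∀ x, |f x| ≤ 1) → (∀ x, |g x| ≤ 1) →
      0 ≤ K → 0 ≤ K' → (∀ x y, |f x - f y| ≤ K * |x - y|) → (∀ x y, |g x - g y| ≤ K' * |x - y|) →
      |cov[fun ω => f (∑ b ∈ B, W b ω), fun ω => g (∑ b ∈ B', W b ω); P]| ≤
        lambdaPsi (∑ b ∈ B, A b) (∑ b ∈ B', A b) K K' * lam r

lemma memLp_two_of_abs_le {X : Ω → ℝ} (hX : Measurable X) {C : ℝ} (h : ∀ ω, |X ω| ≤ C) :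
    MemLp X 2 P :=
  MemLp.of_bound hX.aestronglyMeasurable C (Eventually.of_forall h)

lemma integral_exp_eq_cos_add_sin {X : Ω → ℝ} (hX : Measurable X) :
    ∫ ω, Complex.exp (X ω * Complex.I) ∂P =
      (∫ ω, Real.cos (X ω) ∂P : ℝ) + (∫ ω, Real.sin (X ω) ∂P : ℝ) * Complex.I := by
  have i1 : Integrable (fun ω => ((Real.cos (X ω) : ℝ) : ℂ)) P :=
    ((memLp_two_of_abs_le (by fun_prop) (fun ω => Real.abs_cos_le_one (X ω))).integrable
      (by norm_num)).ofReal
  have i2 : Integrable (fun ω => ((Real.sin (X ω) : ℝ) : ℂ)) P :=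
    ((memLp_two_of_abs_le (by fun_prop) (fun ω => Real.abs_sin_le_one (X ω))).integrable
      (by norm_num)).ofReal
  rw [← integral_complex_ofReal, ← integral_complex_ofReal, ← integral_mul_const,
    ← integral_add i1 (i2.mul_const Complex.I)]
  simp [Complex.exp_mul_I]

/-- The defect of multiplicativity of characteristic functions, in terms of the covariances of
cosines and sines. -/
lemma norm_integral_exp_add_sub_mul_le {X Y : Ω → ℝ} (hX : Measurable X) (hY : Measurable Y)
    {D : ℝ}
    (hcc : |cov[fun ω => Real.cos (X ω), fun ω => Real.cos (Y ω); P]| ≤ D)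
    (hss : |cov[fun ω => Real.sin (X ω), fun ω => Real.sin (Y ω); P]| ≤ D)
    (hcs : |cov[fun ω => Real.cos (X ω), fun ω => Real.sin (Y ω); P]| ≤ D)
    (hsc : |cov[fun ω => Real.sin (X ω), fun ω => Real.cos (Y ω); P]| ≤ D) :
    ‖∫ ω, Complex.exp ((X ω + Y ω : ℝ) * Complex.I) ∂P -
      (∫ ω, Complex.exp (X ω * Complex.I) ∂P) * ∫ ω, Complex.exp (Y ω * Complex.I) ∂P‖ ≤
        4 * D := by
  have mc : ∀ {Z : Ω → ℝ}, Measurable Z → MemLp (fun ω => Real.cos (Z ω)) 2 P := fun hZ =>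
    memLp_two_of_abs_le (by fun_prop) (fun ω => Real.abs_cos_le_one _)
  have ms : ∀ {Z : Ω → ℝ}, Measurable Z → MemLp (fun ω => Real.sin (Z ω)) 2 P := fun hZ =>
    memLp_two_of_abs_le (by fun_prop) (fun ω => Real.abs_sin_le_one _)
  rw [covariance_eq_sub (mc hX) (mc hY)] at hcc
  rw [covariance_eq_sub (ms hX) (ms hY)] at hss
  rw [covariance_eq_sub (mc hX) (ms hY)] at hcs
  rw [covariance_eq_sub (ms hX) (mc hY)] at hsc
  simp only [Pi.mul_apply] at hcc hss hcs hsc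
  rw [integral_exp_eq_cos_add_sin (X := fun ω => X ω + Y ω) (hX.add hY), integral_exp_eq_cos_add_sin hX,
    integral_exp_eq_cos_add_sin hY]
  have e1 : ∫ ω, Real.cos (X ω + Y ω) ∂P =
      ∫ ω, Real.cos (X ω) * Real.cos (Y ω) ∂P - ∫ ω, Real.sin (X ω) * Real.sin (Y ω) ∂P := by
    simp_rw [Real.cos_add]
    exact integral_sub ((mc hX).integrable_mul (mc hY)) ((ms hX).integrable_mul (ms hY))
  have e2 : ∫ ω, Real.sin (X ω + Y ω) ∂P =
      ∫ ω, Real.sin (X ω) * Real.cos (Y ω) ∂P + ∫ ω, Real.cos (X ω) * Real.sin (Y ω) ∂P := by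
    simp_rw [Real.sin_add]
    exact integral_add ((ms hX).integrable_mul (mc hY)) ((mc hX).integrable_mul (ms hY))
  rw [e1, e2]
  set cc := ∫ ω, Real.cos (X ω) * Real.cos (Y ω) ∂P
  set ss := ∫ ω, Real.sin (X ω) * Real.sin (Y ω) ∂P
  set cs := ∫ ω, Real.cos (X ω) * Real.sin (Y ω) ∂P
  set sc := ∫ ω, Real.sin (X ω) * Real.cos (Y ω) ∂P
  set cX := ∫ ω, Real.cos (X ω) ∂P
  set cY := ∫ ω, Real.cos (Y ω) ∂P
  set sX := ∫ ω, Real.sin (X ω) ∂P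
  set sY := ∫ ω, Real.sin (Y ω) ∂P
  have e : ((cc - ss : ℝ) : ℂ) + ((sc + cs : ℝ) : ℂ) * Complex.I -
      ((cX : ℂ) + sX * Complex.I) * ((cY : ℂ) + sY * Complex.I) =
      (((cc - cX * cY) - (ss - sX * sY) : ℝ) : ℂ) +
        (((sc - sX * cY) + (cs - cX * sY) : ℝ) : ℂ) * Complex.I := by
    push_cast
    linear_combination (-(sX : ℂ) * sY) * Complex.I_sq
  rw [e]
  refine (norm_add_le _ _).trans ?_
  rw [norm_mul, Complex.norm_I, mul_one, Complex.norm_real, Complex.norm_real, Real.norm_eq_abs,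
    Real.norm_eq_abs]
  have h1 := abs_sub (cc - cX * cY) (ss - sX * sY)
  have h2 := abs_add_le (sc - sX * cY) (cs - cX * sY)
  linarith

lemma IsBlockWeaklyDependent.norm_integral_exp_le {W : ℕ → Ω → ℝ} {A lam : ℕ → ℝ}
    (hW : ∀ i, Measurable (W i)) (h : IsBlockWeaklyDependent P W A lam) {r : ℕ}
    {B B' : Finset ℕ} (hB : ∀ b ∈ B, ∀ b' ∈ B', b + r < b') {c : ℝ} (hc : 0 ≤ c) :
    ‖∫ ω, Complex.exp ((c * ∑ b ∈ B, W b ω + c * ∑ b ∈ B', W b ω : ℝ) * Complex.I) ∂P -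
      (∫ ω, Complex.exp ((c * ∑ b ∈ B, W b ω : ℝ) * Complex.I) ∂P) *
        ∫ ω, Complex.exp ((c * ∑ b ∈ B', W b ω : ℝ) * Complex.I) ∂P‖ ≤
      4 * (lambdaPsi (∑ b ∈ B, A b) (∑ b ∈ B', A b) c c * lam r) := by
  have lc : ∀ x y : ℝ, |Real.cos (c * x) - Real.cos (c * y)| ≤ c * |x - y| := fun x y => by
    have := Real.lipschitzWith_cos.dist_le_mul (c * x) (c * y)
    rw [Real.dist_eq, Real.dist_eq, ← mul_sub, abs_mul, abs_of_nonneg hc] at this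
    simpa using this
  have ls : ∀ x y : ℝ, |Real.sin (c * x) - Real.sin (c * y)| ≤ c * |x - y| := fun x y => by
    have := Real.lipschitzWith_sin.dist_le_mul (c * x) (c * y)
    rw [Real.dist_eq, Real.dist_eq, ← mul_sub, abs_mul, abs_of_nonneg hc] at this
    simpa using this
  have bc : ∀ x : ℝ, |Real.cos (c * x)| ≤ 1 := fun x => Real.abs_cos_le_one _
  have bs : ∀ x : ℝ, |Real.sin (c * x)| ≤ 1 := fun x => Real.abs_sin_le_one _
  have mB : ∀ B : Finset ℕ, Measurable fun ω => c * ∑ b ∈ B, W b ω := fun B =>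
    (Finset.measurable_sum B fun b _ => hW b).const_mul c
  exact norm_integral_exp_add_sub_mul_le (mB B) (mB B')
    (h r B B' hB _ _ c c bc bc hc hc lc lc) (h r B B' hB _ _ c c bs bs hc hc ls ls)
    (h r B B' hB _ _ c c bc bs hc hc lc ls) (h r B B' hB _ _ c c bs bc hc hc ls lc)

/-- Decoupling of separated blocks: the blocks are split off one after the other, so that each
step costs the covariance of one block with the union of the preceding ones. -/
lemma IsBlockWeaklyDependent.norm_integral_exp_sub_prod_le {W : ℕ → Ω → ℝ} {A lam : ℕ → ℝ}
    (hW : ∀ i, Measurable (W i)) (hA : ∀ i, 0 ≤ A i) (h : IsBlockWeaklyDependent P W A lam)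
    {r : ℕ} (hlam : 0 ≤ lam r) {B : ℕ → Finset ℕ}
    (hB : ∀ l j, l < j → ∀ b ∈ B l, ∀ b' ∈ B j, b + r < b') {c : ℝ} (hc : 0 ≤ c) (k : ℕ) {S : ℝ}
    (hS : ∑ j ∈ Finset.range k, ∑ b ∈ B j, A b ≤ S) :
    ‖∫ ω, Complex.exp ((c * ∑ j ∈ Finset.range k, ∑ b ∈ B j, W b ω : ℝ) * Complex.I) ∂P -
      ∏ j ∈ Finset.range k, ∫ ω, Complex.exp ((c * ∑ b ∈ B j, W b ω : ℝ) * Complex.I) ∂P‖ ≤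
      4 * ((k * (c * S) + c * S + c * c * S * S) * lam r) := by
  have ha : ∀ j, 0 ≤ ∑ b ∈ B j, A b := fun j => Finset.sum_nonneg fun b _ => hA b
  have hdisj : ∀ n, ∀ f : ℕ → ℝ, ∑ b ∈ (Finset.range n).biUnion B, f b =
      ∑ j ∈ Finset.range n, ∑ b ∈ B j, f b := fun n f => by
    refine Finset.sum_biUnion fun l _ j _ hlj => ?_
    rw [Function.onFun, Finset.disjoint_left]
    intro b hbl hbj
    rcases lt_or_gt_of_ne hlj with hlt | hlt
    · have := hB l j hlt b hbl b hbj; omega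
    · have := hB j l hlt b hbj b hbl; omega
  have step : ∀ n, n ≤ k →
      ‖∫ ω, Complex.exp ((c * ∑ j ∈ Finset.range n, ∑ b ∈ B j, W b ω : ℝ) * Complex.I) ∂P -
      ∏ j ∈ Finset.range n, ∫ ω, Complex.exp ((c * ∑ b ∈ B j, W b ω : ℝ) * Complex.I) ∂P‖ ≤
      ∑ j ∈ Finset.range n, 4 * ((c * S + c * ∑ b ∈ B j, A b +
        c * c * S * ∑ b ∈ B j, A b) * lam r) := by
    intro n
    induction n with
    | zero => simp
    | succ n ih =>
      intro hn
      rw [Finset.prod_range_succ, Finset.sum_range_succ]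
      have hsep : ∀ b ∈ (Finset.range n).biUnion B, ∀ b' ∈ B n, b + r < b' := by
        intro b hb b' hb'
        obtain ⟨l, hl, hbl⟩ := Finset.mem_biUnion.1 hb
        exact hB l n (Finset.mem_range.1 hl) b hbl b' hb'
      have h1 := h.norm_integral_exp_le hW hsep hc
      simp_rw [hdisj n] at h1
      have hle : ∑ j ∈ Finset.range n, ∑ b ∈ B j, A b ≤ S :=
        (Finset.sum_le_sum_of_subset_of_nonneg (Finset.range_mono (by omega))
          fun j _ _ => ha j).trans hS
      have h2 : 4 * (lambdaPsi (∑ j ∈ Finset.range n, ∑ b ∈ B j, A b) (∑ b ∈ B n, A b) c c *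
          lam r) ≤ 4 * ((c * S + c * ∑ b ∈ B n, A b + c * c * S * ∑ b ∈ B n, A b) * lam r) := by
        unfold lambdaPsi
        gcongr
        exact ha n
      have e : ∀ ω, c * ∑ j ∈ Finset.range (n + 1), ∑ b ∈ B j, W b ω =
          c * ∑ j ∈ Finset.range n, ∑ b ∈ B j, W b ω + c * ∑ b ∈ B n, W b ω := fun ω => by
        rw [Finset.sum_range_succ, mul_add]
      simp_rw [e]
      refine (norm_sub_le_norm_sub_add_norm_sub _ _ _).trans
        ((add_le_add (h1.trans h2) ?_).trans (le_of_eq (add_comm _ _)))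
      rw [← sub_mul, norm_mul]
      exact (mul_le_of_le_one_right (norm_nonneg _) (norm_integral_exp_le_one _)).trans
        (ih (by omega))
  refine (step k le_rfl).trans ?_
  rw [← Finset.mul_sum, ← Finset.sum_mul]
  refine mul_le_mul_of_nonneg_left (mul_le_mul_of_nonneg_right ?_ hlam) (by norm_num)
  have hS0 : 0 ≤ S := (Finset.sum_nonneg fun j _ => ha j).trans hS
  rw [Finset.sum_add_distrib, Finset.sum_add_distrib, Finset.sum_const, Finset.card_range,
    nsmul_eq_mul, ← Finset.mul_sum, ← Finset.mul_sum]
  gcongr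

/-! ### Covariance inequality -/

/-- Truncation of a real number at level `T`. -/
def clip (T x : ℝ) : ℝ := max (-T) (min T x)

lemma abs_clip_le {T : ℝ} (hT : 0 ≤ T) (x : ℝ) : |clip T x| ≤ T :=
  abs_le.2 ⟨le_max_left _ _, max_le (by linarith) (min_le_left _ _)⟩

lemma abs_clip_sub_clip_le (T x y : ℝ) : |clip T x - clip T y| ≤ |x - y| := by
  refine (abs_max_sub_max_le_max _ _ _ _).trans ?_
  rw [sub_self, abs_zero, max_eq_right (abs_nonneg _)]
  refine (abs_min_sub_min_le_max _ _ _ _).trans ?_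
  rw [sub_self, abs_zero, max_eq_right (abs_nonneg _)]

lemma clip_of_abs_le {T x : ℝ} (h : |x| ≤ T) : clip T x = x := by
  rw [clip, min_eq_right (abs_le.1 h).2, max_eq_right (abs_le.1 h).1]

lemma abs_clip_le_abs {T : ℝ} (hT : 0 ≤ T) (x : ℝ) : |clip T x| ≤ |x| := by
  have := abs_clip_sub_clip_le T x 0
  rwa [clip_of_abs_le (by simpa using hT : |(0 : ℝ)| ≤ T), sub_zero, sub_zero] at this

lemma abs_sub_clip_le {T : ℝ} (hT : 0 ≤ T) (x : ℝ) : |x - clip T x| ≤ |x| := by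
  unfold clip
  rcases le_total 0 x with h | h
  · rw [max_eq_right (le_min (by linarith) (by linarith)), abs_of_nonneg h,
      abs_of_nonneg (by linarith [min_le_right T x])]
    linarith [le_min hT h]
  · rw [min_eq_right (by linarith), abs_of_nonpos h, abs_of_nonpos (by linarith [le_max_right (-T) x])]
    linarith [max_le (by linarith : -T ≤ 0) h]

lemma measurable_clip (T : ℝ) : Measurable (clip T) := by
  unfold clip; fun_prop

lemma mul_abs_sub_clip_le {δ T : ℝ} (hδ : 0 < δ) (hT : 0 < T) (x : ℝ) :
    T * |x - clip T x| ≤ T ^ (-δ) * |x| ^ (2 + δ) := by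
  rcases le_total |x| T with h | h
  · rw [clip_of_abs_le h]
    simpa using mul_nonneg (Real.rpow_nonneg hT.le _) (Real.rpow_nonneg (abs_nonneg x) _)
  · have h1 := sq_le_rpow_mul_of_le_abs hδ hT h
    have h2 := abs_sub_clip_le hT.le x
    have h3 : x ^ 2 = |x| * |x| := by rw [← sq_abs, sq]
    nlinarith [abs_nonneg (x - clip T x)]

lemma abs_mul_sub_clip_mul_clip_le {δ T : ℝ} (hδ : 0 < δ) (hT : 0 < T) (x y : ℝ) :
    |x * y - clip T x * clip T y| ≤ 2 * T ^ (-δ) * (|x| ^ (2 + δ) + |y| ^ (2 + δ)) := by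
  have hT' : 0 ≤ T ^ (-δ) := Real.rpow_nonneg hT.le _
  have px : 0 ≤ T ^ (-δ) * |x| ^ (2 + δ) := mul_nonneg hT' (Real.rpow_nonneg (abs_nonneg x) _)
  have py : 0 ≤ T ^ (-δ) * |y| ^ (2 + δ) := mul_nonneg hT' (Real.rpow_nonneg (abs_nonneg y) _)
  have hxy : |x * y - clip T x * clip T y| ≤ 2 * (|x| * |y|) := by
    refine (abs_sub _ _).trans ?_
    rw [abs_mul, abs_mul]
    have := mul_le_mul (abs_clip_le_abs hT.le x) (abs_clip_le_abs hT.le y) (abs_nonneg _)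
      (abs_nonneg x)
    linarith
  by_cases h : |x| ≤ T ∧ |y| ≤ T
  · rw [clip_of_abs_le h.1, clip_of_abs_le h.2, sub_self, abs_zero]
    linarith
  · refine hxy.trans ?_
    have hor : T < |x| ∨ T < |y| := by
      by_contra hc
      push Not at hc
      exact h hc
    rcases le_total |x| |y| with hle | hle
    · have hTy : T ≤ |y| := by rcases hor with h | h <;> linarith
      have h1 := sq_le_rpow_mul_of_le_abs hδ hT hTy
      rw [← sq_abs] at h1
      nlinarith [abs_nonneg x, abs_nonneg y]
    · have hTx : T ≤ |x| := by rcases hor with h | h <;> linarith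
      have h1 := sq_le_rpow_mul_of_le_abs hδ hT hTx
      rw [← sq_abs] at h1
      nlinarith [abs_nonneg x, abs_nonneg y]

/-- Passing from a product moment to the covariance of the truncated variables. -/
lemma abs_integral_mul_le_cov_clip {δ T : ℝ} (hδ : 0 < δ) (hT : 0 < T) {X Y : Ω → ℝ}
    (hX : Measurable X) (hY : Measurable Y)
    (hXi : Integrable (fun ω => |X ω| ^ (2 + δ)) P) (hYi : Integrable (fun ω => |Y ω| ^ (2 + δ)) P)
    (hX0 : ∫ ω, X ω ∂P = 0) :
    |∫ ω, X ω * Y ω ∂P| ≤ |cov[fun ω => clip T (X ω), fun ω => clip T (Y ω); P]| +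
      3 * T ^ (-δ) * (∫ ω, |X ω| ^ (2 + δ) ∂P + ∫ ω, |Y ω| ^ (2 + δ) ∂P) := by
  have mcl : ∀ {Z : Ω → ℝ}, Measurable Z → MemLp (fun ω => clip T (Z ω)) 2 P := fun hZ =>
    memLp_two_of_abs_le ((measurable_clip T).comp hZ) (fun ω => abs_clip_le hT.le _)
  have hT' : 0 ≤ T ^ (-δ) := Real.rpow_nonneg hT.le _
  have hx0 : 0 ≤ ∫ ω, |X ω| ^ (2 + δ) ∂P :=
    integral_nonneg fun ω => Real.rpow_nonneg (abs_nonneg _) _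
  have hy0 : 0 ≤ ∫ ω, |Y ω| ^ (2 + δ) ∂P :=
    integral_nonneg fun ω => Real.rpow_nonneg (abs_nonneg _) _
  have ixy : Integrable (fun ω => X ω * Y ω) P :=
    (memLp_two_of_integrable_rpow hδ hX hXi).integrable_mul
      (memLp_two_of_integrable_rpow hδ hY hYi)
  have icc : Integrable (fun ω => clip T (X ω) * clip T (Y ω)) P := (mcl hX).integrable_mul (mcl hY)
  have iX := integrable_of_integrable_rpow hδ hX hXi
  have iC : Integrable (fun ω => clip T (X ω)) P := (mcl hX).integrable (by norm_num)
  have h1 : |∫ ω, X ω * Y ω ∂P - ∫ ω, clip T (X ω) * clip T (Y ω) ∂P| ≤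
      2 * T ^ (-δ) * (∫ ω, |X ω| ^ (2 + δ) ∂P + ∫ ω, |Y ω| ^ (2 + δ) ∂P) := by
    rw [← integral_sub ixy icc, ← integral_add hXi hYi, ← integral_const_mul]
    refine (abs_integral_le_integral_abs).trans ?_
    exact integral_mono (ixy.sub icc).abs ((hXi.add hYi).const_mul _)
      fun ω => abs_mul_sub_clip_mul_clip_le hδ hT _ _
  have h2 : T * |∫ ω, clip T (X ω) ∂P| ≤ T ^ (-δ) * ∫ ω, |X ω| ^ (2 + δ) ∂P := by
    have e : ∫ ω, clip T (X ω) ∂P = -∫ ω, (X ω - clip T (X ω)) ∂P := by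
      rw [integral_sub iX iC, hX0]; ring
    rw [e, abs_neg, ← integral_const_mul]
    refine (mul_le_mul_of_nonneg_left abs_integral_le_integral_abs hT.le).trans ?_
    rw [← integral_const_mul]
    exact integral_mono ((iX.sub iC).abs.const_mul _) (hXi.const_mul _)
      fun ω => mul_abs_sub_clip_le hδ hT _
  have h3 : |∫ ω, clip T (Y ω) ∂P| ≤ T := by
    have := norm_integral_le_of_norm_le_const (μ := P) (f := fun ω => clip T (Y ω)) (C := T)
      (Eventually.of_forall fun ω => abs_clip_le hT.le _)
    simpa using this
  have h4 : |(∫ ω, clip T (X ω) ∂P) * ∫ ω, clip T (Y ω) ∂P| ≤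
      T ^ (-δ) * ∫ ω, |X ω| ^ (2 + δ) ∂P := by
    rw [abs_mul, mul_comm]
    exact (mul_le_mul_of_nonneg_right h3 (abs_nonneg _)).trans h2
  rw [covariance_eq_sub (mcl hX) (mcl hY)]
  simp only [Pi.mul_apply]
  set a := ∫ ω, X ω * Y ω ∂P
  set b := ∫ ω, clip T (X ω) * clip T (Y ω) ∂P
  set m := (∫ ω, clip T (X ω) ∂P) * ∫ ω, clip T (Y ω) ∂P
  have h5 : |a| ≤ |b - m| + |a - b| + |m| := by
    have e : a = (b - m) + (a - b) + m := by ring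
    calc |a| = |(b - m) + (a - b) + m| := by rw [← e]
      _ ≤ _ := abs_add_three _ _ _
  have := mul_nonneg hT' hy0
  linarith

lemma abs_cov_clip_div_le_two {T : ℝ} (hT : 0 < T) {X Y : Ω → ℝ} (hX : Measurable X)
    (hY : Measurable Y) :
    |cov[fun ω => clip T (X ω) / T, fun ω => clip T (Y ω) / T; P]| ≤ 2 := by
  have hb : ∀ x, |clip T x / T| ≤ 1 := fun x => by
    rw [abs_div, abs_of_pos hT, div_le_one hT]; exact abs_clip_le hT.le x
  have mcl : ∀ {Z : Ω → ℝ}, Measurable Z → MemLp (fun ω => clip T (Z ω) / T) 2 P := fun hZ =>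
    memLp_two_of_abs_le (((measurable_clip T).comp hZ).div_const T) (fun ω => hb _)
  rw [covariance_eq_sub (mcl hX) (mcl hY)]
  have hle : ∀ {f : Ω → ℝ}, (∀ ω, |f ω| ≤ 1) → |∫ ω, f ω ∂P| ≤ 1 := fun {f} hf => by
    have := norm_integral_le_of_norm_le_const (μ := P) (f := f) (C := 1) (Eventually.of_forall hf)
    simpa using this
  have h1 := hle (f := fun ω => clip T (X ω) / T) fun ω => hb _
  have h2 := hle (f := fun ω => clip T (Y ω) / T) fun ω => hb _
  have h3 := hle (f := (fun ω => clip T (X ω) / T) * fun ω => clip T (Y ω) / T) fun ω => by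
    rw [Pi.mul_apply, abs_mul]; exact mul_le_one₀ (hb _) (abs_nonneg _) (hb _)
  refine (abs_sub _ _).trans ?_
  rw [abs_mul]
  have := mul_le_one₀ h1 (abs_nonneg _) h2
  linarith

/-- Covariance inequality. The coefficient enters through its square root `s`: in this way the
bound is linear in the control sequence `A`, whose square need not be integrable along the
environment. -/
lemma IsBlockWeaklyDependent.abs_integral_mul_le {W : ℕ → Ω → ℝ} {A lam : ℕ → ℝ} {δ : ℝ}
    (hδ : 0 < δ) (hW : ∀ i, Measurable (W i)) (hA : ∀ i, 0 ≤ A i)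
    (hint : ∀ i, Integrable (fun ω => |W i ω| ^ (2 + δ)) P)
    (hmom : ∀ i, ∫ ω, |W i ω| ^ (2 + δ) ∂P ≤ A i) (h0 : ∀ i, ∫ ω, W i ω ∂P = 0)
    (h : IsBlockWeaklyDependent P W A lam) {i j r : ℕ} (hij : i + r < j) {C s T : ℝ} (hC : 1 ≤ C)
    (hs0 : 0 ≤ s) (hs1 : s ≤ 1) (hlam : lam r ≤ C * s ^ 2) (hT : 0 < T) :
    |∫ ω, W i ω * W j ω ∂P| ≤ (3 * T ^ (-δ) + 2 * C * (s * T)) * (A i + A j) := by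
  have h1 := abs_integral_mul_le_cov_clip hδ hT (hW i) (hW j) (hint i) (hint j) (h0 i)
  have hT' : 0 ≤ T ^ (-δ) := Real.rpow_nonneg hT.le _
  have h2 : 3 * T ^ (-δ) * (∫ ω, |W i ω| ^ (2 + δ) ∂P + ∫ ω, |W j ω| ^ (2 + δ) ∂P) ≤
      3 * T ^ (-δ) * (A i + A j) := by
    gcongr
    · exact hmom i
    · exact hmom j
  set q := cov[fun ω => clip T (W i ω) / T, fun ω => clip T (W j ω) / T; P] with hq
  have hcov : cov[fun ω => clip T (W i ω), fun ω => clip T (W j ω); P] = T ^ 2 * q := by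
    rw [hq, covariance_fun_div_left, covariance_fun_div_right]
    field_simp
  have hq2 : |q| ≤ 2 := abs_cov_clip_div_le_two hT (hW i) (hW j)
  have hlip : ∀ x y, |clip T x / T - clip T y / T| ≤ T⁻¹ * |x - y| := fun x y => by
    rw [← sub_div, abs_div, abs_of_pos hT, div_eq_inv_mul]
    exact mul_le_mul_of_nonneg_left (abs_clip_sub_clip_le T x y) (inv_nonneg.2 hT.le)
  have hb : ∀ x, |clip T x / T| ≤ 1 := fun x => by
    rw [abs_div, abs_of_pos hT, div_le_one hT]; exact abs_clip_le hT.le x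
  have hq1 : |q| ≤ lambdaPsi (A i) (A j) T⁻¹ T⁻¹ * lam r := by
    have := h r {i} {j} (by simpa using hij) (fun x => clip T x / T) (fun x => clip T x / T)
      T⁻¹ T⁻¹ hb hb (inv_nonneg.2 hT.le) (inv_nonneg.2 hT.le) hlip hlip
    simpa using this
  set v := T⁻¹ * A i with hv
  set w := T⁻¹ * A j with hw
  have hv0 : 0 ≤ v := mul_nonneg (inv_nonneg.2 hT.le) (hA i)
  have hw0 : 0 ≤ w := mul_nonneg (inv_nonneg.2 hT.le) (hA j)
  have hpsi : lambdaPsi (A i) (A j) T⁻¹ T⁻¹ = v + w + v * w := by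
    rw [lambdaPsi, hv, hw]; ring
  rw [hpsi] at hq1
  have hq3 : |q| ≤ (v + w + v * w) * (C * s ^ 2) :=
    hq1.trans (mul_le_mul_of_nonneg_left hlam (by positivity))
  have hfin : |q| ≤ 2 * C * s * (v + w) := by
    set u := s * (v + w) with hu
    have hu0 : 0 ≤ u := mul_nonneg hs0 (by linarith)
    rcases le_total u 1 with hu1 | hu1
    · have a1 : (v + w) * s ^ 2 ≤ u := by
        rw [hu, sq]; nlinarith [mul_nonneg hs0 (add_nonneg hv0 hw0)]
      have a2 : v * w * s ^ 2 ≤ u := by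
        have : v * w ≤ (v + w) ^ 2 := by nlinarith [mul_nonneg hv0 hw0]
        calc v * w * s ^ 2 ≤ (v + w) ^ 2 * s ^ 2 := by gcongr
          _ = u * u := by rw [hu]; ring
          _ ≤ u := by nlinarith
      calc |q| ≤ _ := hq3
        _ = C * ((v + w) * s ^ 2 + v * w * s ^ 2) := by ring
        _ ≤ C * (u + u) := by gcongr
        _ = 2 * C * s * (v + w) := by rw [hu]; ring
    · calc |q| ≤ 2 := hq2
        _ ≤ 2 * (C * u) := by nlinarith
        _ = 2 * C * s * (v + w) := by rw [hu]; ring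
  have hTq : |T ^ 2 * q| ≤ 2 * C * (s * T) * (A i + A j) := by
    rw [abs_mul, abs_of_nonneg (sq_nonneg T)]
    refine (mul_le_mul_of_nonneg_left hfin (sq_nonneg T)).trans (le_of_eq ?_)
    rw [hv, hw]
    field_simp
  rw [hcov] at h1
  linarith

end

/-! ### Weighted averages of the control sequence -/

/-- The averages of `A` are uniformly integrable: bounded weights of vanishing mean have a vanishing
mean against `A`. -/
def HasUniformAverages (A : ℕ → ℝ) : Prop :=
  ∀ (c : ℕ → ℕ → ℝ) (R : ℝ), (∀ N i, 0 ≤ c N i) → (∀ N i, c N i ≤ R) →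
    Tendsto (fun N : ℕ => (∑ i ∈ Finset.range N, c N i) / N) atTop (𝓝 0) →
      Tendsto (fun N : ℕ => (∑ i ∈ Finset.range N, c N i * A i) / N) atTop (𝓝 0)

lemma sum_dist_le_two_mul_tsum {g : ℕ → ℝ} (hg : Summable g) (h0 : ∀ n, 0 ≤ g n) (i : ℕ)
    (S : Finset ℕ) : ∑ j ∈ S, g (Nat.dist i j) ≤ 2 * ∑' n, g n := by
  rw [← Finset.sum_filter_add_sum_filter_not S (· ≤ i), two_mul]
  have aux : ∀ S : Finset ℕ, Set.InjOn (Nat.dist i) S →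
      ∑ j ∈ S, g (Nat.dist i j) ≤ ∑' n, g n := fun S hS => by
    rw [← Finset.sum_image (f := g) hS]
    exact hg.sum_le_tsum _ fun n _ => h0 n
  refine add_le_add (aux _ ?_) (aux _ ?_)
  · intro a ha b hb hab
    have ha := (Finset.mem_filter.1 ha).2
    have hb := (Finset.mem_filter.1 hb).2
    simp only [Nat.dist] at hab
    omega
  · intro a ha b hb hab
    have ha := (Finset.mem_filter.1 ha).2
    have hb := (Finset.mem_filter.1 hb).2
    simp only [Nat.dist] at hab
    omega

/-- Negligible families `e` of pairs of indices carry a negligible part of the sum of the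
covariances. -/
lemma HasUniformAverages.tendsto_sum_sum {A : ℕ → ℝ} (hA : HasUniformAverages A) {ρ : ℕ → ℝ}
    (hρ : Summable ρ) (hρ0 : ∀ n, 0 ≤ ρ n) {e : ℕ → ℕ → ℕ → ℝ} (he0 : ∀ N i j, 0 ≤ e N i j)
    (he1 : ∀ N i j, e N i j ≤ 1) (hsymm : ∀ N i j, e N i j = e N j i)
    (h : Tendsto (fun N : ℕ => (∑ i ∈ Finset.range N, ∑ j ∈ Finset.range N,
      e N i j * ρ (Nat.dist i j)) / N) atTop (𝓝 0)) :
    Tendsto (fun N : ℕ => (∑ i ∈ Finset.range N, ∑ j ∈ Finset.range N,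
      e N i j * ((A i + A j) * ρ (Nat.dist i j))) / N) atTop (𝓝 0) := by
  set c : ℕ → ℕ → ℝ := fun N i => ∑ j ∈ Finset.range N, e N i j * ρ (Nat.dist i j) with hc
  have h1 := hA c (2 * ∑' n, ρ n)
    (fun N i => Finset.sum_nonneg fun j _ => mul_nonneg (he0 N i j) (hρ0 _))
    (fun N i => (Finset.sum_le_sum fun j _ =>
      mul_le_of_le_one_left (hρ0 _) (he1 N i j)).trans (sum_dist_le_two_mul_tsum hρ hρ0 i _)) h
  have h2 := h1.const_mul 2
  rw [mul_zero] at h2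
  refine h2.congr fun N => ?_
  rw [← mul_div_assoc]
  congr 1
  have e1 : ∑ i ∈ Finset.range N, ∑ j ∈ Finset.range N, e N i j * (A i * ρ (Nat.dist i j)) =
      ∑ i ∈ Finset.range N, c N i * A i := by
    refine Finset.sum_congr rfl fun i _ => ?_
    rw [hc, Finset.sum_mul]
    exact Finset.sum_congr rfl fun j _ => by ring
  have e2 : ∑ i ∈ Finset.range N, ∑ j ∈ Finset.range N, e N i j * (A j * ρ (Nat.dist i j)) =
      ∑ i ∈ Finset.range N, c N i * A i := by
    rw [← e1, Finset.sum_comm]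
    exact Finset.sum_congr rfl fun j _ => Finset.sum_congr rfl fun i _ => by
      rw [hsymm, Nat.dist_comm]
  rw [two_mul]
  nth_rw 1 [← e1]
  rw [← e2, ← Finset.sum_add_distrib]
  refine Finset.sum_congr rfl fun i _ => ?_
  rw [← Finset.sum_add_distrib]
  exact Finset.sum_congr rfl fun j _ => by ring

/-! ### Bernstein blocks -/

/-- The `j`-th large block of `{0, …, N - 1}`: large blocks of length `p` alternate with gaps of
length `q`. -/
def block (N p q j : ℕ) : Finset ℕ :=
  (Finset.range N).filter fun i => i % (p + q) < p ∧ i / (p + q) = j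

/-- The indices of `{0, …, N - 1}` that lie in the gaps between the large blocks. -/
def gaps (N p q : ℕ) : Finset ℕ :=
  (Finset.range N).filter fun i => ¬ i % (p + q) < p

/-- The number of blocks needed to cover `{0, …, N - 1}`. -/
def blockCount (N p q : ℕ) : ℕ := N / (p + q) + 1

/-- Weight `0` for pairs of indices that share a large block, and weight `1` for the other ones. -/
def crossWeight (p q i j : ℕ) : ℝ :=
  if i % (p + q) < p ∧ j % (p + q) < p ∧ i / (p + q) = j / (p + q) then 0 else 1

lemma block_separated {N p q l j : ℕ} (hlj : l < j) :
    ∀ b ∈ block N p q l, ∀ b' ∈ block N p q j, b + q < b' := by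
  intro b hb b' hb'
  obtain ⟨-, hb1, hb2⟩ := Finset.mem_filter.1 hb
  obtain ⟨-, -, hb2'⟩ := Finset.mem_filter.1 hb'
  have h1 := Nat.div_add_mod b (p + q)
  have h2 := Nat.div_add_mod b' (p + q)
  rw [hb2] at h1
  rw [hb2'] at h2
  have h3 : (p + q) * (l + 1) ≤ (p + q) * j := Nat.mul_le_mul_left _ hlj
  rw [mul_add, mul_one] at h3
  omega

lemma card_block_le {N p q j : ℕ} : (block N p q j).card ≤ p := by
  conv_rhs => rw [← Finset.card_range p]
  refine Finset.card_le_card_of_injOn (· % (p + q))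
    (fun i hi => ?_) fun i hi i' hi' h => ?_
  · simpa using (Finset.mem_filter.1 hi).2.1
  · have h1 := Nat.div_add_mod i (p + q)
    have h2 := Nat.div_add_mod i' (p + q)
    rw [(Finset.mem_filter.1 hi).2.2] at h1
    rw [(Finset.mem_filter.1 hi').2.2] at h2
    simp only at h
    rw [← h1, ← h2, h]

lemma card_gaps_le {N p q : ℕ} (hp : 0 < p) : (gaps N p q).card ≤ blockCount N p q * q := by
  rw [← Finset.card_range (blockCount N p q), ← Finset.card_range q, ← Finset.card_product,
    Finset.card_range q]
  refine Finset.card_le_card_of_injOn (fun i => (i / (p + q), i % (p + q) - p))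
    (fun i hi => ?_) fun i hi i' hi' h => ?_
  · have h1 := Finset.mem_filter.1 hi
    have h2 : i / (p + q) ≤ N / (p + q) := Nat.div_le_div_right (Finset.mem_range.1 h1.1).le
    have h3 := Nat.mod_lt i (show p + q > 0 by omega)
    have h4 := h1.2
    simp only [Finset.coe_product, Finset.coe_range, Set.mem_prod, Set.mem_Iio, blockCount]
    omega
  · have h1 := Nat.div_add_mod i (p + q)
    have h2 := Nat.div_add_mod i' (p + q)
    have h3 := (Finset.mem_filter.1 hi).2
    have h4 := (Finset.mem_filter.1 hi').2
    simp only [Prod.mk.injEq] at h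
    rw [h.1] at h1
    omega

lemma sum_block_eq {α : Type*} [AddCommMonoid α] (N p q : ℕ) (f : ℕ → α) :
    ∑ j ∈ Finset.range (blockCount N p q), ∑ i ∈ block N p q j, f i =
      ∑ i ∈ (Finset.range N).filter (fun i => i % (p + q) < p), f i := by
  rw [← Finset.sum_fiberwise_of_maps_to (t := Finset.range (blockCount N p q))
    (s := (Finset.range N).filter (fun i => i % (p + q) < p)) (g := fun i => i / (p + q))]
  · refine Finset.sum_congr rfl fun j _ => ?_
    rw [block, Finset.filter_filter]
  · intro i hi
    have h1 := Finset.mem_range.1 (Finset.mem_filter.1 hi).1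
    have h2 : i / (p + q) ≤ N / (p + q) := Nat.div_le_div_right h1.le
    simp only [Finset.mem_range, blockCount]
    omega

lemma sum_block_add_sum_gaps {α : Type*} [AddCommMonoid α] (N p q : ℕ) (f : ℕ → α) :
    ∑ j ∈ Finset.range (blockCount N p q), ∑ i ∈ block N p q j, f i + ∑ i ∈ gaps N p q, f i =
      ∑ i ∈ Finset.range N, f i := by
  rw [sum_block_eq, gaps, Finset.sum_filter_add_sum_filter_not]

lemma sum_block_le {N p q : ℕ} {f : ℕ → ℝ} (hf : ∀ i, 0 ≤ f i) :
    ∑ j ∈ Finset.range (blockCount N p q), ∑ i ∈ block N p q j, f i ≤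
      ∑ i ∈ Finset.range N, f i := by
  rw [← sum_block_add_sum_gaps N p q f]
  exact le_add_of_nonneg_right (Finset.sum_nonneg fun i _ => hf i)

lemma sum_block_sum_block_eq (N p q : ℕ) (f : ℕ → ℕ → ℝ) :
    ∑ k ∈ Finset.range (blockCount N p q), ∑ i ∈ block N p q k, ∑ j ∈ block N p q k, f i j =
      ∑ i ∈ Finset.range N, ∑ j ∈ Finset.range N, f i j -
        ∑ i ∈ Finset.range N, ∑ j ∈ Finset.range N, crossWeight p q i j * f i j := by
  have h : ∀ k, ∀ i ∈ block N p q k, ∑ j ∈ block N p q k, f i j =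
      ∑ j ∈ (Finset.range N).filter (fun j => j % (p + q) < p ∧ j / (p + q) = i / (p + q)),
        f i j := fun k i hi => by
    rw [block, (Finset.mem_filter.1 hi).2.2]
  rw [Finset.sum_congr rfl fun k _ => Finset.sum_congr rfl (h k), sum_block_eq,
    ← Finset.sum_sub_distrib, Finset.sum_filter]
  refine Finset.sum_congr rfl fun i _ => ?_
  rw [← Finset.sum_sub_distrib]
  by_cases hi : i % (p + q) < p
  · rw [if_pos hi, Finset.sum_filter]
    refine Finset.sum_congr rfl fun j _ => ?_
    by_cases hj : j % (p + q) < p ∧ j / (p + q) = i / (p + q)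
    · rw [if_pos hj, crossWeight, if_pos ⟨hi, hj.1, hj.2.symm⟩]; ring
    · rw [if_neg hj, crossWeight, if_neg fun h => hj ⟨h.2.1, h.2.2.symm⟩]; ring
  · rw [if_neg hi]
    refine (Finset.sum_eq_zero fun j _ => ?_).symm
    rw [crossWeight, if_neg fun h => hi h.1]; ring

lemma crossWeight_nonneg (p q i j : ℕ) : 0 ≤ crossWeight p q i j := by
  unfold crossWeight; split_ifs <;> norm_num

lemma crossWeight_le_one (p q i j : ℕ) : crossWeight p q i j ≤ 1 := by
  unfold crossWeight; split_ifs <;> norm_num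

lemma crossWeight_comm (p q i j : ℕ) : crossWeight p q i j = crossWeight p q j i := by
  unfold crossWeight
  congr 1
  exact propext ⟨fun h => ⟨h.2.1, h.1, h.2.2.symm⟩, fun h => ⟨h.2.1, h.1, h.2.2.symm⟩⟩

/-- Indices that do not share a large block are at distance at least `q`, unless one of them lies
in a gap. -/
lemma crossWeight_mul_le {p q : ℕ} {ρ : ℕ → ℝ} (hρ0 : ∀ n, 0 ≤ ρ n) (i j : ℕ) :
    crossWeight p q i j * ρ (Nat.dist i j) ≤
      (if ¬ i % (p + q) < p then ρ (Nat.dist i j) else 0) +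
      (if ¬ j % (p + q) < p then ρ (Nat.dist i j) else 0) +
      (if q ≤ Nat.dist i j then ρ (Nat.dist i j) else 0) := by
  have h0 := hρ0 (Nat.dist i j)
  have n1 : 0 ≤ if ¬ i % (p + q) < p then ρ (Nat.dist i j) else 0 := by split_ifs <;> simp [h0]
  have n2 : 0 ≤ if ¬ j % (p + q) < p then ρ (Nat.dist i j) else 0 := by split_ifs <;> simp [h0]
  have n3 : 0 ≤ if q ≤ Nat.dist i j then ρ (Nat.dist i j) else 0 := by split_ifs <;> simp [h0]
  have h1 : crossWeight p q i j * ρ (Nat.dist i j) ≤ ρ (Nat.dist i j) :=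
    mul_le_of_le_one_left h0 (crossWeight_le_one p q i j)
  by_cases hi : i % (p + q) < p
  swap
  · rw [if_pos hi]; linarith
  by_cases hj : j % (p + q) < p
  swap
  · rw [if_pos hj]; linarith
  by_cases hij : i / (p + q) = j / (p + q)
  · rw [crossWeight, if_pos ⟨hi, hj, hij⟩]; linarith
  · have hq : q ≤ Nat.dist i j := by
      have hm : ∀ a, a ∈ block (i + j + 1) p q (a / (p + q)) ∨ ¬ (a < i + j + 1 ∧ a % (p + q) < p) :=
        fun a => by
          by_cases h : a < i + j + 1 ∧ a % (p + q) < p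
          · exact Or.inl (Finset.mem_filter.2 ⟨Finset.mem_range.2 h.1, h.2, rfl⟩)
          · exact Or.inr h
      have hi' := (hm i).resolve_right (not_not.2 ⟨by omega, hi⟩)
      have hj' := (hm j).resolve_right (not_not.2 ⟨by omega, hj⟩)
      rcases lt_or_gt_of_ne hij with h | h
      · have := block_separated h i hi' j hj'
        simp only [Nat.dist]; omega
      · have := block_separated h j hj' i hi'
        simp only [Nat.dist]; omega
    rw [if_pos hq]; linarith

lemma sum_crossWeight_le {N p q : ℕ} (hp : 0 < p) {ρ : ℕ → ℝ} (hρ : Summable ρ)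
    (hρ0 : ∀ n, 0 ≤ ρ n) :
    ∑ i ∈ Finset.range N, ∑ j ∈ Finset.range N, crossWeight p q i j * ρ (Nat.dist i j) ≤
      2 * ((blockCount N p q * q : ℕ) * (2 * ∑' n, ρ n)) +
        N * (2 * ∑' n, if q ≤ n then ρ n else 0) := by
  have hR : 0 ≤ 2 * ∑' n, ρ n := mul_nonneg (by norm_num) (tsum_nonneg hρ0)
  have g1 : ∑ i ∈ Finset.range N, ∑ j ∈ Finset.range N,
      (if ¬ i % (p + q) < p then ρ (Nat.dist i j) else 0) ≤
      (blockCount N p q * q : ℕ) * (2 * ∑' n, ρ n) := by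
    have : ∀ i ∈ Finset.range N, ∑ j ∈ Finset.range N,
        (if ¬ i % (p + q) < p then ρ (Nat.dist i j) else 0) ≤
        if ¬ i % (p + q) < p then 2 * ∑' n, ρ n else 0 := fun i _ => by
      split_ifs
      · simp
      · exact sum_dist_le_two_mul_tsum hρ hρ0 i _
    refine (Finset.sum_le_sum this).trans ?_
    rw [← Finset.sum_filter, Finset.sum_const, nsmul_eq_mul]
    exact mul_le_mul_of_nonneg_right (Nat.cast_le.2 (card_gaps_le hp)) hR
  have g2 : ∑ i ∈ Finset.range N, ∑ j ∈ Finset.range N,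
      (if ¬ j % (p + q) < p then ρ (Nat.dist i j) else 0) ≤
      (blockCount N p q * q : ℕ) * (2 * ∑' n, ρ n) := by
    rw [Finset.sum_comm]
    simp_rw [Nat.dist_comm]
    exact g1
  have g3 : ∑ i ∈ Finset.range N, ∑ j ∈ Finset.range N,
      (if q ≤ Nat.dist i j then ρ (Nat.dist i j) else 0) ≤
      N * (2 * ∑' n, if q ≤ n then ρ n else 0) := by
    have hs : Summable fun n => if q ≤ n then ρ n else 0 :=
      Summable.of_nonneg_of_le (fun n => by split_ifs <;> simp [hρ0])
        (fun n => by split_ifs <;> simp [hρ0]) hρ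
    have := Finset.sum_le_sum fun i (_ : i ∈ Finset.range N) =>
      sum_dist_le_two_mul_tsum hs (fun n => by split_ifs <;> simp [hρ0]) i (Finset.range N)
    simpa using this
  refine (Finset.sum_le_sum fun i _ => Finset.sum_le_sum fun j _ =>
    crossWeight_mul_le hρ0 i j).trans ?_
  simp_rw [Finset.sum_add_distrib]
  linarith

lemma tendsto_tsum_tail {ρ : ℕ → ℝ} (hρ : Summable ρ) (hρ0 : ∀ n, 0 ≤ ρ n) {q : ℕ → ℕ}
    (hq : Tendsto q atTop atTop) :
    Tendsto (fun N => ∑' n, if q N ≤ n then ρ n else 0) atTop (𝓝 0) := by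
  have := tendsto_tsum_of_dominated_convergence (𝓕 := atTop)
    (f := fun N n => if q N ≤ n then ρ n else 0) (g := fun _ => (0 : ℝ)) hρ (fun n => ?_)
    (Eventually.of_forall fun N n => ?_)
  · simpa using this
  · refine tendsto_const_nhds.congr' ?_
    filter_upwards [hq.eventually_gt_atTop n] with N hN
    rw [if_neg (by omega)]
  · split_ifs <;> simp [hρ0, abs_of_nonneg]

/-- The covariances between indices that do not share a large block are negligible. -/
lemma HasUniformAverages.tendsto_sum_crossWeight {A : ℕ → ℝ} (hA : HasUniformAverages A)
    {ρ : ℕ → ℝ} (hρ : Summable ρ) (hρ0 : ∀ n, 0 ≤ ρ n) {p q : ℕ → ℕ} (hp : ∀ N, 0 < p N)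
    (hq : Tendsto q atTop atTop)
    (hkq : Tendsto (fun N : ℕ => (blockCount N (p N) (q N) * q N : ℝ) / N) atTop (𝓝 0)) :
    Tendsto (fun N : ℕ => (∑ i ∈ Finset.range N, ∑ j ∈ Finset.range N,
      crossWeight (p N) (q N) i j * ((A i + A j) * ρ (Nat.dist i j))) / N) atTop (𝓝 0) := by
  refine hA.tendsto_sum_sum hρ hρ0 (fun N => crossWeight_nonneg _ _)
    (fun N => crossWeight_le_one _ _) (fun N => crossWeight_comm _ _) ?_
  have hlim : Tendsto (fun N : ℕ => 2 * ((blockCount N (p N) (q N) * q N : ℝ) / N *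
      (2 * ∑' n, ρ n)) + 2 * ∑' n, if q N ≤ n then ρ n else 0) atTop
      (𝓝 (2 * (0 * (2 * ∑' n, ρ n)) + 2 * 0)) :=
    ((hkq.mul_const _).const_mul 2).add ((tendsto_tsum_tail hρ hρ0 hq).const_mul 2)
  rw [zero_mul, mul_zero, add_zero] at hlim
  refine tendsto_of_tendsto_of_tendsto_of_le_of_le' tendsto_const_nhds hlim
    (Eventually.of_forall fun N => ?_) ?_
  · exact div_nonneg (Finset.sum_nonneg fun i _ => Finset.sum_nonneg fun j _ =>
      mul_nonneg (crossWeight_nonneg _ _ _ _) (hρ0 _)) (Nat.cast_nonneg N)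
  · filter_upwards [eventually_gt_atTop 0] with N hN
    have hN' : (0 : ℝ) < N := Nat.cast_pos.2 hN
    rw [div_le_iff₀ hN']
    refine (sum_crossWeight_le (hp N) hρ hρ0).trans (le_of_eq ?_)
    push_cast
    field_simp

/-! ### Central limit theorem for block weakly dependent sequences -/

section

variable {Ω : Type*} [MeasurableSpace Ω] {P : Measure Ω}

lemma norm_exp_sub_exp_le (x y : ℝ) :
    ‖Complex.exp (x * Complex.I) - Complex.exp (y * Complex.I)‖ ≤ |x - y| := by
  have e : Complex.exp (x * Complex.I) - Complex.exp (y * Complex.I) =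
      Complex.exp (y * Complex.I) * (Complex.exp (Complex.I * ((x - y : ℝ) : ℂ)) - 1) := by
    rw [mul_sub, ← Complex.exp_add, mul_one]
    congr 2
    push_cast
    ring
  rw [e, norm_mul, Complex.norm_exp_ofReal_mul_I, one_mul]
  exact Real.norm_exp_I_mul_ofReal_sub_one_le

lemma norm_integral_exp_sub_integral_exp_le [IsProbabilityMeasure P] {X Y : Ω → ℝ} (hX : Measurable X) (hY : Measurable Y)
    (h2 : Integrable (fun ω => (X ω - Y ω) ^ 2) P) :
    ‖∫ ω, Complex.exp (X ω * Complex.I) ∂P - ∫ ω, Complex.exp (Y ω * Complex.I) ∂P‖ ≤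
      √(∫ ω, (X ω - Y ω) ^ 2 ∂P) := by
  have hm : MemLp (fun ω => X ω - Y ω) 2 P :=
    (memLp_two_iff_integrable_sq (hX.sub hY).aestronglyMeasurable).2 h2
  have hi : Integrable (fun ω => X ω - Y ω) P := hm.integrable (by norm_num)
  have h1 : ‖∫ ω, Complex.exp (X ω * Complex.I) ∂P - ∫ ω, Complex.exp (Y ω * Complex.I) ∂P‖ ≤
      ∫ ω, |X ω - Y ω| ∂P := by
    rw [← integral_sub (integrable_exp_ofReal_mul_I hX) (integrable_exp_ofReal_mul_I hY)]
    refine (norm_integral_le_integral_norm _).trans ?_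
    exact integral_mono ((integrable_exp_ofReal_mul_I hX).sub (integrable_exp_ofReal_mul_I hY)).norm
      hi.abs fun ω => norm_exp_sub_exp_le _ _
  refine h1.trans (Real.le_sqrt_of_sq_le ?_)
  have hv := variance_nonneg (fun ω => |X ω - Y ω|) P
  have hma : MemLp (fun ω => |X ω - Y ω|) 2 P := hm.abs
  rw [variance_eq_sub hma] at hv
  simpa [sq_abs] using hv

lemma memLp_const_mul_sum {ι : Type*} {W : ι → Ω → ℝ}
    (hW : ∀ i, MemLp (W i) 2 P) (c : ℝ) (B : Finset ι) :
    MemLp (fun ω => c * ∑ i ∈ B, W i ω) 2 P :=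
  (memLp_finsetSum B fun i _ => hW i).const_mul c

lemma integral_sq_sum_eq {ι : Type*} {W : ι → Ω → ℝ}
    (hW : ∀ i, MemLp (W i) 2 P) (B : Finset ι) :
    ∫ ω, (∑ i ∈ B, W i ω) ^ 2 ∂P = ∑ i ∈ B, ∑ j ∈ B, ∫ ω, W i ω * W j ω ∂P := by
  have h : ∀ i j, Integrable (fun ω => W i ω * W j ω) P := fun i j => (hW i).integrable_mul (hW j)
  simp_rw [sq, Finset.sum_mul_sum]
  rw [integral_finsetSum _ fun i _ => integrable_finsetSum _ fun j _ => h i j]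
  exact Finset.sum_congr rfl fun i _ => integral_finsetSum _ fun j _ => h i j

lemma abs_sum_rpow_le {δ : ℝ} (hδ : 0 < δ) (B : Finset ℕ) (f : ℕ → ℝ) :
    |∑ i ∈ B, f i| ^ (2 + δ) ≤ (B.card : ℝ) ^ (1 + δ) * ∑ i ∈ B, |f i| ^ (2 + δ) := by
  refine (Real.rpow_le_rpow (abs_nonneg _) (Finset.abs_sum_le_sum_abs f B) (by linarith)).trans ?_
  have := Real.rpow_sum_le_const_mul_sum_rpow B f (p := 2 + δ) (by linarith)
  rwa [show 2 + δ - 1 = 1 + δ by ring] at this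

lemma integrable_abs_mul_sum_rpow {δ : ℝ}
    (hδ : 0 < δ) {W : ℕ → Ω → ℝ}
    (hW : ∀ i, Measurable (W i)) (hint : ∀ i, Integrable (fun ω => |W i ω| ^ (2 + δ)) P)
    (c : ℝ) (B : Finset ℕ) :
    Integrable (fun ω => |c * ∑ i ∈ B, W i ω| ^ (2 + δ)) P := by
  have hm : Measurable fun ω => |c * ∑ i ∈ B, W i ω| ^ (2 + δ) :=
    (measurable_norm.comp ((Finset.measurable_sum B fun i _ => hW i).const_mul c)).pow_const _
  refine Integrable.mono' ((integrable_finsetSum B fun i _ => hint i).const_mul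
    (|c| ^ (2 + δ) * (B.card : ℝ) ^ (1 + δ))) hm.aestronglyMeasurable
    (Eventually.of_forall fun ω => ?_)
  rw [Real.norm_eq_abs, abs_of_nonneg (Real.rpow_nonneg (abs_nonneg _) _), abs_mul,
    Real.mul_rpow (abs_nonneg _) (abs_nonneg _), mul_assoc]
  exact mul_le_mul_of_nonneg_left (abs_sum_rpow_le hδ B fun i => W i ω)
    (Real.rpow_nonneg (abs_nonneg _) _)

lemma integral_abs_mul_sum_rpow_le {δ : ℝ} (hδ : 0 < δ) {W : ℕ → Ω → ℝ} {A : ℕ → ℝ}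
    (hW : ∀ i, Measurable (W i)) (hint : ∀ i, Integrable (fun ω => |W i ω| ^ (2 + δ)) P)
    (hmom : ∀ i, ∫ ω, |W i ω| ^ (2 + δ) ∂P ≤ A i) {c : ℝ} (hc : 0 ≤ c) (B : Finset ℕ) {p : ℕ}
    (hp : B.card ≤ p) :
    ∫ ω, |c * ∑ i ∈ B, W i ω| ^ (2 + δ) ∂P ≤
      c ^ (2 + δ) * ((p : ℝ) ^ (1 + δ) * ∑ i ∈ B, A i) := by
  have h0 : ∀ i, 0 ≤ ∫ ω, |W i ω| ^ (2 + δ) ∂P :=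
    fun i => integral_nonneg fun ω => Real.rpow_nonneg (abs_nonneg _) _
  have h1 : ∫ ω, |c * ∑ i ∈ B, W i ω| ^ (2 + δ) ∂P ≤
      ∫ ω, c ^ (2 + δ) * ((B.card : ℝ) ^ (1 + δ) * ∑ i ∈ B, |W i ω| ^ (2 + δ)) ∂P := by
    refine integral_mono (integrable_abs_mul_sum_rpow hδ hW hint c B)
      (((integrable_finsetSum B fun i _ => hint i).const_mul _).const_mul _) fun ω => ?_
    simp only
    rw [abs_mul, abs_of_nonneg hc, Real.mul_rpow hc (abs_nonneg _)]
    exact mul_le_mul_of_nonneg_left (abs_sum_rpow_le hδ B fun i => W i ω) (Real.rpow_nonneg hc _)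
  rw [integral_const_mul, integral_const_mul, integral_finsetSum _ fun i _ => hint i] at h1
  refine h1.trans (mul_le_mul_of_nonneg_left ?_ (Real.rpow_nonneg hc _))
  have h2 : (B.card : ℝ) ^ (1 + δ) ≤ (p : ℝ) ^ (1 + δ) :=
    Real.rpow_le_rpow (Nat.cast_nonneg _) (Nat.cast_le.2 hp) (by linarith)
  exact mul_le_mul h2 (Finset.sum_le_sum fun i _ => hmom i)
    (Finset.sum_nonneg fun i _ => h0 i) (Real.rpow_nonneg (Nat.cast_nonneg _) _)

lemma tendsto_sq_blocks {W : ℕ → Ω → ℝ} {A : ℕ → ℝ} (hW2 : ∀ i, MemLp (W i) 2 P)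
    {ρ : ℕ → ℝ} (hcov : ∀ i j, |∫ ω, W i ω * W j ω ∂P| ≤ (A i + A j) * ρ (Nat.dist i j))
    {p q : ℕ → ℕ}
    (hcross : Tendsto (fun N : ℕ => (∑ i ∈ Finset.range N, ∑ j ∈ Finset.range N,
      crossWeight (p N) (q N) i j * ((A i + A j) * ρ (Nat.dist i j))) / N) atTop (𝓝 0))
    {v : ℝ} (hv : Tendsto (fun N : ℕ => (∑ i ∈ Finset.range N, ∑ j ∈ Finset.range N,
      ∫ ω, W i ω * W j ω ∂P) / N) atTop (𝓝 v)) :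
    Tendsto (fun N : ℕ => ∑ k ∈ Finset.range (blockCount N (p N) (q N)),
      ∫ ω, ((√N)⁻¹ * ∑ i ∈ block N (p N) (q N) k, W i ω) ^ 2 ∂P) atTop (𝓝 v) := by
  have h0 : Tendsto (fun N : ℕ => (∑ i ∈ Finset.range N, ∑ j ∈ Finset.range N,
      crossWeight (p N) (q N) i j * ∫ ω, W i ω * W j ω ∂P) / N) atTop (𝓝 0) := by
    refine squeeze_zero_norm (fun N => ?_) hcross
    rw [norm_div, Real.norm_natCast]
    refine div_le_div_of_nonneg_right ((norm_sum_le _ _).trans (Finset.sum_le_sum fun i _ =>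
      (norm_sum_le _ _).trans (Finset.sum_le_sum fun j _ => ?_))) (Nat.cast_nonneg N)
    rw [norm_mul, Real.norm_eq_abs, Real.norm_eq_abs, abs_of_nonneg (crossWeight_nonneg _ _ _ _)]
    exact mul_le_mul_of_nonneg_left (hcov i j) (crossWeight_nonneg _ _ _ _)
  have h1 := hv.sub h0
  rw [sub_zero] at h1
  refine h1.congr fun N => ?_
  rw [← sub_div, ← sum_block_sum_block_eq, Finset.sum_div]
  refine Finset.sum_congr rfl fun k _ => ?_
  simp_rw [mul_pow]
  rw [integral_const_mul, integral_sq_sum_eq hW2, inv_pow, Real.sq_sqrt (Nat.cast_nonneg N),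
    div_eq_inv_mul]

lemma tendsto_lyapunov_blocks {δ : ℝ} (hδ : 0 < δ) {W : ℕ → Ω → ℝ} {A : ℕ → ℝ}
    (hW : ∀ i, Measurable (W i)) (hA : ∀ i, 0 ≤ A i)
    (hint : ∀ i, Integrable (fun ω => |W i ω| ^ (2 + δ)) P)
    (hmom : ∀ i, ∫ ω, |W i ω| ^ (2 + δ) ∂P ≤ A i) {M : ℝ}
    (hM : ∀ N : ℕ, ∑ i ∈ Finset.range N, A i ≤ M * N) {p q : ℕ → ℕ}
    (hpδ : Tendsto (fun N : ℕ => (p N : ℝ) ^ (1 + δ) * (N : ℝ) ^ (-(δ / 2))) atTop (𝓝 0)) :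
    Tendsto (fun N : ℕ => ∑ k ∈ Finset.range (blockCount N (p N) (q N)),
      ∫ ω, |(√N)⁻¹ * ∑ i ∈ block N (p N) (q N) k, W i ω| ^ (2 + δ) ∂P) atTop (𝓝 0) := by
  have h1 := hpδ.const_mul M
  rw [mul_zero] at h1
  refine tendsto_of_tendsto_of_tendsto_of_le_of_le' tendsto_const_nhds h1
    (Eventually.of_forall fun N => Finset.sum_nonneg fun k _ => integral_nonneg fun ω =>
      Real.rpow_nonneg (abs_nonneg _) _) ?_
  filter_upwards [eventually_gt_atTop 0] with N hN
  have hN' : (0 : ℝ) < N := Nat.cast_pos.2 hN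
  have hc : (0 : ℝ) ≤ (√N)⁻¹ := inv_nonneg.2 (Real.sqrt_nonneg _)
  refine (Finset.sum_le_sum fun k _ => integral_abs_mul_sum_rpow_le hδ hW hint hmom hc _
    card_block_le).trans ?_
  rw [← Finset.mul_sum, ← Finset.mul_sum]
  have h2 : ∑ k ∈ Finset.range (blockCount N (p N) (q N)), ∑ i ∈ block N (p N) (q N) k, A i ≤
      M * N := (sum_block_le hA).trans (hM N)
  have h3 : (√N)⁻¹ ^ (2 + δ) * N = (N : ℝ) ^ (-(δ / 2)) := by
    rw [Real.sqrt_eq_rpow, ← Real.rpow_neg hN'.le, ← Real.rpow_mul hN'.le]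
    nth_rw 2 [← Real.rpow_one (N : ℝ)]
    rw [← Real.rpow_add hN']
    congr 1
    ring
  calc _ ≤ (√N)⁻¹ ^ (2 + δ) * ((p N : ℝ) ^ (1 + δ) * (M * N)) := by
        gcongr
    _ = M * ((p N : ℝ) ^ (1 + δ) * ((√N)⁻¹ ^ (2 + δ) * N)) := by ring
    _ = _ := by rw [h3]

lemma tendsto_sq_gaps {W : ℕ → Ω → ℝ} {A : ℕ → ℝ} (hA : ∀ i, 0 ≤ A i) (hW2 : ∀ i, MemLp (W i) 2 P)
    {ρ : ℕ → ℝ} (hρ0 : ∀ n, 0 ≤ ρ n)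
    (hcov : ∀ i j, |∫ ω, W i ω * W j ω ∂P| ≤ (A i + A j) * ρ (Nat.dist i j)) {p q : ℕ → ℕ}
    (hcross : Tendsto (fun N : ℕ => (∑ i ∈ Finset.range N, ∑ j ∈ Finset.range N,
      crossWeight (p N) (q N) i j * ((A i + A j) * ρ (Nat.dist i j))) / N) atTop (𝓝 0)) :
    Tendsto (fun N : ℕ => ∫ ω, ((√N)⁻¹ * ∑ i ∈ gaps N (p N) (q N), W i ω) ^ 2 ∂P)
      atTop (𝓝 0) := by
  refine squeeze_zero (fun N => integral_nonneg fun ω => sq_nonneg _) (fun N => ?_) hcross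
  simp_rw [mul_pow]
  rw [integral_const_mul, integral_sq_sum_eq hW2, inv_pow, Real.sq_sqrt (Nat.cast_nonneg N),
    ← div_eq_inv_mul]
  refine div_le_div_of_nonneg_right ?_ (Nat.cast_nonneg N)
  have hnn : ∀ i j, 0 ≤ crossWeight (p N) (q N) i j * ((A i + A j) * ρ (Nat.dist i j)) :=
    fun i j => mul_nonneg (crossWeight_nonneg _ _ _ _)
      (mul_nonneg (add_nonneg (hA i) (hA j)) (hρ0 _))
  have hsub : gaps N (p N) (q N) ⊆ Finset.range N := Finset.filter_subset _ _
  refine (Finset.sum_le_sum fun i hi => Finset.sum_le_sum fun j _ => ?_).trans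
    ((Finset.sum_le_sum_of_subset_of_nonneg hsub fun i _ _ =>
      Finset.sum_nonneg fun j _ => hnn i j).trans (Finset.sum_le_sum fun i _ =>
      Finset.sum_le_sum_of_subset_of_nonneg hsub fun j _ _ => hnn i j))
  have hw : crossWeight (p N) (q N) i j = 1 := if_neg fun h => (Finset.mem_filter.1 hi).2 h.1
  rw [hw, one_mul]
  exact (le_abs_self _).trans (hcov i j)

/-- Bernstein's method: the gaps are negligible in mean square, the large blocks are decoupled by
weak dependence, and Lyapunov's theorem applies to the decoupled blocks. -/
theorem tendsto_integral_exp_of_blocks [IsProbabilityMeasure P] {δ : ℝ} (hδ : 0 < δ) {W : ℕ → Ω → ℝ} {A lam : ℕ → ℝ}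
    (hW : ∀ i, Measurable (W i)) (hA : ∀ i, 0 ≤ A i)
    (hint : ∀ i, Integrable (fun ω => |W i ω| ^ (2 + δ)) P)
    (hmom : ∀ i, ∫ ω, |W i ω| ^ (2 + δ) ∂P ≤ A i) (h0 : ∀ i, ∫ ω, W i ω ∂P = 0)
    (hdep : IsBlockWeaklyDependent P W A lam) (hlam : ∀ r, 0 ≤ lam r)
    {M : ℝ} (hM : ∀ N : ℕ, ∑ i ∈ Finset.range N, A i ≤ M * N) (hunif : HasUniformAverages A)
    {ρ : ℕ → ℝ} (hρ : Summable ρ) (hρ0 : ∀ n, 0 ≤ ρ n)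
    (hcov : ∀ i j, |∫ ω, W i ω * W j ω ∂P| ≤ (A i + A j) * ρ (Nat.dist i j))
    {v : ℝ} (hv : Tendsto (fun N : ℕ => (∑ i ∈ Finset.range N, ∑ j ∈ Finset.range N,
      ∫ ω, W i ω * W j ω ∂P) / N) atTop (𝓝 v))
    {p q : ℕ → ℕ} (hp : ∀ N, 0 < p N) (hq : Tendsto q atTop atTop)
    (hkq : Tendsto (fun N : ℕ => (blockCount N (p N) (q N) * q N : ℝ) / N) atTop (𝓝 0))
    (hpδ : Tendsto (fun N : ℕ => (p N : ℝ) ^ (1 + δ) * (N : ℝ) ^ (-(δ / 2))) atTop (𝓝 0))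
    (hlamq : Tendsto (fun N : ℕ => (blockCount N (p N) (q N) * √N + N) * lam (q N))
      atTop (𝓝 0)) :
    Tendsto (fun N : ℕ => ∫ ω, Complex.exp
      (((√N)⁻¹ * ∑ i ∈ Finset.range N, W i ω : ℝ) * Complex.I) ∂P)
      atTop (𝓝 (Complex.exp (-(v : ℂ) / 2))) := by
  have hW2 : ∀ i, MemLp (W i) 2 P := fun i => memLp_two_of_integrable_rpow hδ (hW i) (hint i)
  have hcross := hunif.tendsto_sum_crossWeight hρ hρ0 hp hq hkq
  have hmeas : ∀ (c : ℝ) (B : Finset ℕ), Measurable fun ω => c * ∑ i ∈ B, W i ω := fun c B =>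
    (Finset.measurable_sum B fun i _ => hW i).const_mul c
  have hprod := tendsto_prod_integral_exp hδ (fun N => blockCount N (p N) (q N))
    (fun N k ω => (√N)⁻¹ * ∑ i ∈ block N (p N) (q N) k, W i ω) (fun N k => hmeas _ _)
    (fun N k => integrable_abs_mul_sum_rpow hδ hW hint _ _)
    (fun N k => by
      rw [integral_const_mul, integral_finsetSum _ fun i _ => (hW2 i).integrable (by norm_num)]
      simp [h0])
    (tendsto_sq_blocks hW2 hcov hcross hv)
    (tendsto_lyapunov_blocks hδ hW hA hint hmom hM hpδ)
  have hM0 : 0 ≤ M := by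
    have := hM 1
    simp only [Finset.range_one, Finset.sum_singleton, Nat.cast_one, mul_one] at this
    exact (hA 0).trans this
  -- decoupling of the large blocks
  have hdec : Tendsto (fun N : ℕ => ∫ ω, Complex.exp (((√N)⁻¹ *
        ∑ k ∈ Finset.range (blockCount N (p N) (q N)), ∑ i ∈ block N (p N) (q N) k, W i ω : ℝ) *
        Complex.I) ∂P - ∏ k ∈ Finset.range (blockCount N (p N) (q N)),
        ∫ ω, Complex.exp (((√N)⁻¹ * ∑ i ∈ block N (p N) (q N) k, W i ω : ℝ) * Complex.I) ∂P)
      atTop (𝓝 0) := by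
    have hlim := hlamq.const_mul (4 * (2 * M + M * M))
    rw [mul_zero] at hlim
    refine squeeze_zero_norm' ?_ hlim
    filter_upwards [eventually_gt_atTop 0] with N hN
    have hN' : (1 : ℝ) ≤ N := by exact_mod_cast hN
    have hs : 0 < √(N : ℝ) := Real.sqrt_pos.2 (by linarith)
    have hss : √(N : ℝ) * √N = N := Real.mul_self_sqrt (by linarith)
    have hs1 : √(N : ℝ) ≤ N := by nlinarith [Real.one_le_sqrt.2 hN']
    have hcN : (√(N : ℝ))⁻¹ * (M * N) = M * √N := by
      field_simp
      rw [sq, hss]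
      ring
    refine (hdep.norm_integral_exp_sub_prod_le hW hA (hlam (q N))
      (fun l j hlj => block_separated hlj) (inv_nonneg.2 hs.le) _
      ((sum_block_le hA).trans (hM N))).trans ?_
    have e : (√(N : ℝ))⁻¹ * (√(N : ℝ))⁻¹ * (M * N) * (M * N) = M * M * N := by
      calc _ = ((√(N : ℝ))⁻¹ * (M * N)) * ((√(N : ℝ))⁻¹ * (M * N)) := by ring
        _ = M * M * (√N * √N) := by rw [hcN]; ring
        _ = _ := by rw [hss]
    rw [e, hcN, mul_assoc 4]
    refine mul_le_mul_of_nonneg_left ?_ (by norm_num)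
    rw [← mul_assoc (2 * M + M * M)]
    refine mul_le_mul_of_nonneg_right ?_ (hlam _)
    have hk0 : (0 : ℝ) ≤ blockCount N (p N) (q N) * √N := by positivity
    have h1 : M * √N ≤ M * N := mul_le_mul_of_nonneg_left hs1 hM0
    have h2 : 0 ≤ M * (blockCount N (p N) (q N) * √N) := mul_nonneg hM0 hk0
    have h3 : 0 ≤ M * M * (blockCount N (p N) (q N) * √N) :=
      mul_nonneg (mul_nonneg hM0 hM0) hk0
    have h4 : 0 ≤ M * N := mul_nonneg hM0 (by linarith)
    nlinarith
  -- the gaps are negligible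
  have hgap : Tendsto (fun N : ℕ => ∫ ω, Complex.exp
        (((√N)⁻¹ * ∑ i ∈ Finset.range N, W i ω : ℝ) * Complex.I) ∂P -
      ∫ ω, Complex.exp (((√N)⁻¹ *
        ∑ k ∈ Finset.range (blockCount N (p N) (q N)), ∑ i ∈ block N (p N) (q N) k, W i ω : ℝ) *
        Complex.I) ∂P) atTop (𝓝 0) := by
    have hlim := (Real.continuous_sqrt.tendsto 0).comp
      (tendsto_sq_gaps hA hW2 hρ0 hcov hcross)
    rw [Real.sqrt_zero] at hlim
    refine squeeze_zero_norm (fun N => ?_) hlim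
    have e : ∀ ω, (√N)⁻¹ * ∑ i ∈ Finset.range N, W i ω - (√N)⁻¹ *
        ∑ k ∈ Finset.range (blockCount N (p N) (q N)), ∑ i ∈ block N (p N) (q N) k, W i ω =
        (√N)⁻¹ * ∑ i ∈ gaps N (p N) (q N), W i ω := fun ω => by
      rw [← sum_block_add_sum_gaps N (p N) (q N)]; ring
    have hb : Measurable fun ω => (√N)⁻¹ * ∑ k ∈ Finset.range (blockCount N (p N) (q N)),
        ∑ i ∈ block N (p N) (q N) k, W i ω :=
      (Finset.measurable_sum _ fun k _ => Finset.measurable_sum _ fun i _ => hW i).const_mul _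
    have := norm_integral_exp_sub_integral_exp_le (P := P) (hmeas (√N)⁻¹ (Finset.range N)) hb
      (by
        simp_rw [e]
        exact (memLp_const_mul_sum hW2 _ _).integrable_sq)
    simp_rw [e] at this
    exact this
  simpa using (hgap.add hdec).add hprod

end

/-! ### Polynomial rates -/

lemma tendsto_const_mul_natCast_rpow {x : ℝ} (hx : x < 0) (C : ℝ) :
    Tendsto (fun N : ℕ => C * (N : ℝ) ^ x) atTop (𝓝 0) := by
  have h := (tendsto_rpow_neg_atTop (y := -x) (by linarith)).comp
    (tendsto_natCast_atTop_atTop (R := ℝ))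
  simpa using h.const_mul C

lemma exists_block_exponents {δ ℓ : ℝ} (hδ : 0 < δ) (hℓ : 2 + 3 / δ < ℓ) :
    ∃ a b : ℝ, 0 < b ∧ b < a ∧ a * (1 + δ) < δ / 2 ∧ 3 / 2 < ℓ * b + a := by
  have h3 : 0 < 3 / δ := by positivity
  set c := δ / (2 * (1 + δ)) with hc
  have hc0 : 0 < c := by positivity
  have hcδ : c * (1 + δ) = δ / 2 := by rw [hc]; field_simp
  have hkey : 3 / 2 < (ℓ + 1) * c := by
    have h1 : 3 + 2 * δ < ℓ * δ := by
      have := mul_lt_mul_of_pos_right hℓ hδ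
      rw [add_mul, div_mul_cancel₀ _ hδ.ne'] at this
      linarith
    rw [hc, mul_div_assoc', lt_div_iff₀ (by positivity)]
    nlinarith
  set g := (ℓ + 1) * c - 3 / 2 with hg
  have hg0 : 0 < g := by linarith
  have hl : 0 < 2 * ℓ + 1 := by linarith
  set t := min (c / 4) (g / (2 * (2 * ℓ + 1))) with ht
  have ht0 : 0 < t := lt_min (by positivity) (by positivity)
  have ht1 : t ≤ c / 4 := min_le_left _ _
  have ht2 : (2 * ℓ + 1) * t ≤ g / 2 := by
    have : t ≤ g / (2 * (2 * ℓ + 1)) := min_le_right _ _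
    rw [le_div_iff₀ (by positivity)] at this
    linarith
  refine ⟨c - t, c - 2 * t, by linarith, by linarith, ?_, ?_⟩
  · nlinarith
  · have : ℓ * (c - 2 * t) + (c - t) = (ℓ + 1) * c - (2 * ℓ + 1) * t := by ring
    rw [this]
    linarith

lemma floor_add_one_bounds {x : ℝ} (hx : 0 ≤ x) {N : ℕ} (hN : 0 < N) :
    (N : ℝ) ^ x ≤ (⌊(N : ℝ) ^ x⌋₊ + 1 : ℕ) ∧ ((⌊(N : ℝ) ^ x⌋₊ + 1 : ℕ) : ℝ) ≤ 2 * (N : ℝ) ^ x := by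
  have h1 : (1 : ℝ) ≤ (N : ℝ) ^ x := Real.one_le_rpow (by exact_mod_cast hN) hx
  push_cast
  exact ⟨(Nat.lt_floor_add_one _).le, by linarith [Nat.floor_le (zero_le_one.trans h1)]⟩

/-- Block lengths of order `N ^ a` and gaps of order `N ^ b`: the blocks are short enough for
Lyapunov's condition, even if the moments of block sums are estimated by convexity only, and the
gaps are negligible, yet long enough for the decoupling. -/
lemma exists_block_lengths {δ ℓ : ℝ} (hδ : 0 < δ) (hℓ : 2 + 3 / δ < ℓ) {C : ℝ} (hC : 0 ≤ C) :
    ∃ p q : ℕ → ℕ, (∀ N, 0 < p N) ∧ Tendsto q atTop atTop ∧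
      Tendsto (fun N : ℕ => (blockCount N (p N) (q N) * q N : ℝ) / N) atTop (𝓝 0) ∧
      Tendsto (fun N : ℕ => (p N : ℝ) ^ (1 + δ) * (N : ℝ) ^ (-(δ / 2))) atTop (𝓝 0) ∧
      Tendsto (fun N : ℕ => (blockCount N (p N) (q N) * √N + N) *
        (C * ((q N : ℝ) + 1) ^ (-ℓ))) atTop (𝓝 0) := by
  obtain ⟨a, b, hb0, hba, haδ, hℓab⟩ := exists_block_exponents hδ hℓ
  have h3 : 0 < 3 / δ := by positivity
  have hℓ0 : 0 < ℓ := by linarith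
  have ha0 : 0 < a := hb0.trans hba
  have ha1 : a < 1 / 2 := by nlinarith
  set p : ℕ → ℕ := fun N => ⌊(N : ℝ) ^ a⌋₊ + 1 with hp
  set q : ℕ → ℕ := fun N => ⌊(N : ℝ) ^ b⌋₊ + 1 with hq
  have hk : ∀ N : ℕ, 0 < N → (blockCount N (p N) (q N) : ℝ) ≤ 2 * (N : ℝ) ^ (1 - a) := by
    intro N hN
    have hN' : (0 : ℝ) < N := Nat.cast_pos.2 hN
    have hp1 := (floor_add_one_bounds ha0.le hN).1
    have hd : ((N / (p N + q N) : ℕ) : ℝ) ≤ (N : ℝ) ^ (1 - a) := by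
      refine Nat.cast_div_le.trans ?_
      rw [Real.rpow_sub hN', Real.rpow_one]
      refine div_le_div_of_nonneg_left hN'.le (Real.rpow_pos_of_pos hN' a) ?_
      push_cast
      have : (0 : ℝ) ≤ q N := Nat.cast_nonneg _
      have : (N : ℝ) ^ a ≤ p N := hp1
      linarith
    have h1 : (1 : ℝ) ≤ (N : ℝ) ^ (1 - a) :=
      Real.one_le_rpow (by exact_mod_cast hN) (by linarith)
    rw [blockCount]
    push_cast at hd ⊢
    linarith
  refine ⟨p, q, fun N => Nat.succ_pos _, ?_, ?_, ?_, ?_⟩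
  · have h1 : Tendsto (fun N : ℕ => ⌊(N : ℝ) ^ b⌋₊) atTop atTop :=
      tendsto_nat_floor_atTop.comp ((tendsto_rpow_atTop hb0).comp tendsto_natCast_atTop_atTop)
    exact tendsto_atTop_mono (fun N => Nat.le_succ _) h1
  · refine tendsto_of_tendsto_of_tendsto_of_le_of_le' tendsto_const_nhds
      (tendsto_const_mul_natCast_rpow (x := b - a) (by linarith) 4)
      (Eventually.of_forall fun N => by positivity) ?_
    filter_upwards [eventually_gt_atTop 0] with N hN
    have hN' : (0 : ℝ) < N := Nat.cast_pos.2 hN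
    have hq2 : (q N : ℝ) ≤ 2 * (N : ℝ) ^ b := (floor_add_one_bounds hb0.le hN).2
    rw [div_le_iff₀ hN']
    calc (blockCount N (p N) (q N) * q N : ℝ) ≤ 2 * (N : ℝ) ^ (1 - a) * (2 * (N : ℝ) ^ b) :=
          mul_le_mul (hk N hN) hq2 (Nat.cast_nonneg _) (by positivity)
      _ = 4 * ((N : ℝ) ^ (1 - a) * (N : ℝ) ^ b) := by ring
      _ = 4 * (N : ℝ) ^ (b - a) * N := by
          rw [← Real.rpow_add hN', mul_assoc, ← Real.rpow_add_one hN'.ne']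
          ring_nf
  · refine tendsto_of_tendsto_of_tendsto_of_le_of_le' tendsto_const_nhds
      (tendsto_const_mul_natCast_rpow (x := a * (1 + δ) - δ / 2) (by linarith) (2 ^ (1 + δ)))
      (Eventually.of_forall fun N => by positivity) ?_
    filter_upwards [eventually_gt_atTop 0] with N hN
    have hN' : (0 : ℝ) < N := Nat.cast_pos.2 hN
    have hp2 : (p N : ℝ) ≤ 2 * (N : ℝ) ^ a := (floor_add_one_bounds ha0.le hN).2
    have h1 : (p N : ℝ) ^ (1 + δ) ≤ (2 * (N : ℝ) ^ a) ^ (1 + δ) :=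
      Real.rpow_le_rpow (Nat.cast_nonneg _) hp2 (by linarith)
    refine (mul_le_mul_of_nonneg_right h1 (by positivity)).trans (le_of_eq ?_)
    rw [Real.mul_rpow (by norm_num) (by positivity), ← Real.rpow_mul hN'.le, mul_assoc,
      ← Real.rpow_add hN', sub_eq_add_neg]
  · have hlim := (tendsto_const_mul_natCast_rpow (x := 3 / 2 - a - ℓ * b) (by linarith)
      (2 * C)).add (tendsto_const_mul_natCast_rpow (x := 1 - ℓ * b) (by linarith) C)
    rw [add_zero] at hlim
    refine tendsto_of_tendsto_of_tendsto_of_le_of_le' tendsto_const_nhds hlim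
      (Eventually.of_forall fun N => by positivity) ?_
    filter_upwards [eventually_gt_atTop 0] with N hN
    have hN' : (0 : ℝ) < N := Nat.cast_pos.2 hN
    have hq1 : (N : ℝ) ^ b ≤ q N := (floor_add_one_bounds hb0.le hN).1
    have h1 : ((q N : ℝ) + 1) ^ (-ℓ) ≤ (N : ℝ) ^ (-(ℓ * b)) := by
      have := Real.rpow_le_rpow_of_nonpos (z := -ℓ) (Real.rpow_pos_of_pos hN' b)
        (by linarith : (N : ℝ) ^ b ≤ (q N : ℝ) + 1) (by linarith)
      rwa [← Real.rpow_mul hN'.le, show b * -ℓ = -(ℓ * b) by ring] at this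
    have h2 : (blockCount N (p N) (q N) * √N + N : ℝ) ≤ 2 * (N : ℝ) ^ (1 - a) * √N + N := by
      have := mul_le_mul_of_nonneg_right (hk N hN) (Real.sqrt_nonneg N)
      linarith
    calc (blockCount N (p N) (q N) * √N + N : ℝ) * (C * ((q N : ℝ) + 1) ^ (-ℓ))
        ≤ (2 * (N : ℝ) ^ (1 - a) * √N + N) * (C * (N : ℝ) ^ (-(ℓ * b))) := by gcongr
      _ = 2 * C * ((N : ℝ) ^ (1 - a) * (N : ℝ) ^ (1 / 2 : ℝ) * (N : ℝ) ^ (-(ℓ * b))) +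
          C * ((N : ℝ) ^ (1 : ℝ) * (N : ℝ) ^ (-(ℓ * b))) := by
          rw [Real.sqrt_eq_rpow, Real.rpow_one]; ring
      _ = _ := by
          rw [← Real.rpow_add hN', ← Real.rpow_add hN', ← Real.rpow_add hN']
          ring_nf

section

variable {Ω : Type*} [MeasurableSpace Ω] {P : Measure Ω} [IsProbabilityMeasure P]

/-- For coefficients of order `(r + 1) ^ (-ℓ)`, the covariances decay like the distance of the
indices to the power `-ℓ δ / (2 (1 + δ))`. -/
lemma IsBlockWeaklyDependent.abs_integral_mul_le_rpow {W : ℕ → Ω → ℝ} {A : ℕ → ℝ} {δ ℓ C : ℝ}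
    (hδ : 0 < δ) (hℓ : 0 < ℓ) (hC : 1 ≤ C) (hW : ∀ i, Measurable (W i)) (hA : ∀ i, 0 ≤ A i)
    (hint : ∀ i, Integrable (fun ω => |W i ω| ^ (2 + δ)) P)
    (hmom : ∀ i, ∫ ω, |W i ω| ^ (2 + δ) ∂P ≤ A i) (h0 : ∀ i, ∫ ω, W i ω ∂P = 0)
    (h : IsBlockWeaklyDependent P W A fun r => C * ((r : ℝ) + 1) ^ (-ℓ)) {i j : ℕ} (hij : i < j) :
    |∫ ω, W i ω * W j ω ∂P| ≤
      (A i + A j) * ((3 + 2 * C) * (Nat.dist i j : ℝ) ^ (-(ℓ * δ / (2 * (1 + δ))))) := by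
  set n := Nat.dist i j with hn
  have hn' : n = j - i := by simp [hn, Nat.dist]; omega
  have hn1 : 1 ≤ n := by omega
  have hr : (((n - 1 : ℕ) : ℝ) + 1) = n := by
    rw [Nat.cast_sub hn1]; push_cast; ring
  have hn1' : (1 : ℝ) ≤ n := by exact_mod_cast hn1
  have hn0 : (0 : ℝ) < n := by linarith
  have hT : (0 : ℝ) < (n : ℝ) ^ (ℓ / (2 * (1 + δ))) := Real.rpow_pos_of_pos hn0 _
  have key := h.abs_integral_mul_le hδ hW hA hint hmom h0 (i := i) (j := j) (r := n - 1) (C := C)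
    (s := (n : ℝ) ^ (-(ℓ / 2))) (T := (n : ℝ) ^ (ℓ / (2 * (1 + δ)))) (by omega) hC
    (Real.rpow_nonneg hn0.le _) (Real.rpow_le_one_of_one_le_of_nonpos hn1' (by linarith))
    (by
      rw [hr, ← Real.rpow_natCast, ← Real.rpow_mul hn0.le]
      apply le_of_eq
      congr 2
      push_cast
      ring) hT
  refine key.trans (le_of_eq ?_)
  rw [← Real.rpow_mul hn0.le, ← Real.rpow_add hn0]
  have e1 : ℓ / (2 * (1 + δ)) * -δ = -(ℓ * δ / (2 * (1 + δ))) := by ring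
  have e2 : -(ℓ / 2) + ℓ / (2 * (1 + δ)) = -(ℓ * δ / (2 * (1 + δ))) := by field_simp; ring
  rw [e1, e2]
  ring

/-- Central limit theorem for a centered, block weakly dependent sequence with polynomial
coefficients of exponent larger than `2 + 3 / δ`. -/
theorem tendsto_integral_exp_of_polynomial_rate {W : ℕ → Ω → ℝ} {A : ℕ → ℝ} {δ ℓ C : ℝ}
    (hδ : 0 < δ) (hℓ : 2 + 3 / δ < ℓ) (hC : 1 ≤ C) (hW : ∀ i, Measurable (W i))
    (hA : ∀ i, 1 ≤ A i) (hint : ∀ i, Integrable (fun ω => |W i ω| ^ (2 + δ)) P)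
    (hmom : ∀ i, ∫ ω, |W i ω| ^ (2 + δ) ∂P ≤ A i) (h0 : ∀ i, ∫ ω, W i ω ∂P = 0)
    (hdep : IsBlockWeaklyDependent P W A fun r => C * ((r : ℝ) + 1) ^ (-ℓ))
    {M : ℝ} (hM : ∀ N : ℕ, ∑ i ∈ Finset.range N, A i ≤ M * N) (hunif : HasUniformAverages A)
    {v : ℝ} (hv : Tendsto (fun N : ℕ => (∑ i ∈ Finset.range N, ∑ j ∈ Finset.range N,
      ∫ ω, W i ω * W j ω ∂P) / N) atTop (𝓝 v)) :
    Tendsto (fun N : ℕ => ∫ ω, Complex.exp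
      (((√N)⁻¹ * ∑ i ∈ Finset.range N, W i ω : ℝ) * Complex.I) ∂P)
      atTop (𝓝 (Complex.exp (-(v : ℂ) / 2))) := by
  have h3 : 0 < 3 / δ := by positivity
  have hℓ0 : 0 < ℓ := by linarith
  have hA0 : ∀ i, 0 ≤ A i := fun i => zero_le_one.trans (hA i)
  obtain ⟨p, q, hp, hq, hkq, hpδ, hlamq⟩ := exists_block_lengths hδ hℓ (zero_le_one.trans hC)
  set κ := ℓ * δ / (2 * (1 + δ)) with hκ
  have hκ1 : 1 < κ := by
    have h1 : 3 + 2 * δ < ℓ * δ := by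
      have := mul_lt_mul_of_pos_right hℓ hδ
      rw [add_mul, div_mul_cancel₀ _ hδ.ne'] at this
      linarith
    rw [hκ, lt_div_iff₀ (by positivity)]
    linarith
  -- the additional term at distance `0` accounts for the variances
  set ρ : ℕ → ℝ := fun n => (3 + 2 * C) * ((n : ℝ) ^ (-κ) + if n = 0 then 1 else 0) with hρdef
  have hρ : Summable ρ := by
    refine Summable.mul_left _ (Summable.add (Real.summable_nat_rpow.2 (by linarith)) ?_)
    exact summable_of_ne_finset_zero (s := {0}) fun n hn => if_neg (by simpa using hn)
  have hρ0 : ∀ n, 0 ≤ ρ n := fun n => by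
    refine mul_nonneg (by linarith) (add_nonneg (Real.rpow_nonneg (Nat.cast_nonneg n) _) ?_)
    split_ifs <;> norm_num
  have hlt : ∀ i j, i < j → |∫ ω, W i ω * W j ω ∂P| ≤ (A i + A j) * ρ (Nat.dist i j) := by
    intro i j hij
    refine (hdep.abs_integral_mul_le_rpow hδ hℓ0 hC hW hA0 hint hmom h0 hij).trans ?_
    refine mul_le_mul_of_nonneg_left ?_ (add_nonneg (hA0 i) (hA0 j))
    refine mul_le_mul_of_nonneg_left (le_add_of_nonneg_right ?_) (by linarith)
    split_ifs <;> norm_num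
  have hcov : ∀ i j, |∫ ω, W i ω * W j ω ∂P| ≤ (A i + A j) * ρ (Nat.dist i j) := by
    intro i j
    rcases lt_trichotomy i j with hij | rfl | hij
    · exact hlt i j hij
    · have h1 := integral_sq_le_of_integral_rpow hδ (hW i) (hint i)
      simp_rw [← sq]
      rw [abs_of_nonneg (integral_nonneg fun ω => sq_nonneg _), Nat.dist_self]
      have h2 : 1 ≤ ρ 0 := by
        have := Real.rpow_nonneg (le_refl (0 : ℝ)) (-κ)
        simp only [hρdef, Nat.cast_zero, if_true]
        nlinarith
      have h3 := hmom i
      have h4 := hA i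
      nlinarith
    · have := hlt j i hij
      simp_rw [mul_comm (W i _), add_comm (A i), Nat.dist_comm i]
      exact this
  exact tendsto_integral_exp_of_blocks hδ hW hA0 hint hmom h0 hdep
    (fun r => mul_nonneg (zero_le_one.trans hC) (Real.rpow_nonneg (by positivity) _)) hM hunif hρ
    hρ0 hcov hv hp hq hkq hpδ hlamq

end

/-! ### From weak dependence of the array to weak dependence of block sums -/

lemma HasLipConst.lip_le {k : ℕ} {f : (Fin k → ℝ) → ℝ} {L : ℝ} (h : HasLipConst f L) :
    lip f ≤ L :=
  csInf_le ⟨0, fun _ hL => hL.1⟩ h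

lemma lip_nonneg {k : ℕ} (f : (Fin k → ℝ) → ℝ) : 0 ≤ lip f :=
  Real.sInf_nonneg fun _ hL => hL.1

/-- An enumeration of `B ×ˢ I` along which the individuals are nondecreasing. -/
lemma exists_monotone_enumeration (B : Finset ℕ) (I : Finset ℤ) :
    ∃ (u : ℕ) (i : Fin u → ℕ) (t : Fin u → ℤ), Monotone i ∧ (∀ m, i m ∈ B) ∧ (∀ m, t m ∈ I) ∧
      ∀ g : ℕ → ℤ → ℝ, ∑ m, g (i m) (t m) = ∑ b ∈ B, ∑ t ∈ I, g b t := by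
  set S : Finset (ℕ ×ₗ ℤ) := (B ×ˢ I).map toLex.toEmbedding with hS
  set e := S.orderIsoOfFin rfl with he
  have hmem : ∀ m, ofLex ((e m : S) : ℕ ×ₗ ℤ) ∈ B ×ˢ I := fun m => by
    obtain ⟨x, hx, hxe⟩ := Finset.mem_map.1 (e m).2
    rw [← hxe]
    exact hx
  refine ⟨S.card, fun m => (ofLex ((e m : S) : ℕ ×ₗ ℤ)).1, fun m => (ofLex ((e m : S) : ℕ ×ₗ ℤ)).2,
    fun m m' h => ?_, fun m => (Finset.mem_product.1 (hmem m)).1,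
    fun m => (Finset.mem_product.1 (hmem m)).2, fun g => ?_⟩
  · exact Prod.Lex.monotone_fst _ _ (show ((e m : S) : ℕ ×ₗ ℤ) ≤ (e m' : S) from e.monotone h)
  · have h1 := Equiv.sum_comp e.toEquiv
      (fun x : S => g (ofLex (x : ℕ ×ₗ ℤ)).1 (ofLex (x : ℕ ×ₗ ℤ)).2)
    have h2 : ∑ x ∈ S, g (ofLex x).1 (ofLex x).2 = ∑ x ∈ B ×ˢ I, g x.1 x.2 := by
      rw [hS, Finset.sum_map]
      rfl
    rw [Finset.sum_coe_sort S (fun x => g (ofLex x).1 (ofLex x).2), h2] at h1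
    rw [← Finset.sum_product']
    exact h1

lemma hasLipConst_comp_sum {u : ℕ} {c : Fin u → ℝ} {L K : ℝ} (hc : ∀ m, |c m| ≤ L) (hL : 0 ≤ L)
    {f : ℝ → ℝ} (hK : 0 ≤ K) (hf : ∀ x y, |f x - f y| ≤ K * |x - y|) :
    HasLipConst (fun z : Fin u → ℝ => f (∑ m, c m * z m)) (K * L) := by
  refine ⟨mul_nonneg hK hL, fun z z' => (hf _ _).trans ?_⟩
  rw [mul_assoc]
  refine mul_le_mul_of_nonneg_left ?_ hK
  rw [← Finset.sum_sub_distrib, Finset.mul_sum]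
  refine (Finset.abs_sum_le_sum_abs _ _).trans (Finset.sum_le_sum fun m _ => ?_)
  rw [← mul_sub, abs_mul]
  exact mul_le_mul_of_nonneg_right (hc m) (abs_nonneg _)

lemma lambdaPsi_le {u v a b u' v' a' b' : ℝ} (hu : 0 ≤ u) (hv : 0 ≤ v) (ha : 0 ≤ a) (hb : 0 ≤ b)
    (huu : u ≤ u') (hvv : v ≤ v') (haa : a ≤ a') (hbb : b ≤ b') :
    lambdaPsi u v a b ≤ lambdaPsi u' v' a' b' := by
  have hu' := hu.trans huu
  have hv' := hv.trans hvv
  have ha' := ha.trans haa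
  have hb' := hb.trans hbb
  unfold lambdaPsi
  gcongr

/-- Linear combinations, over finitely many times, of a weakly dependent array observed at the
individuals `1, 2, …` are block weakly dependent. -/
lemma isBlockWeaklyDependent_of_cov_le {Ω : Type*} [MeasurableSpace Ω] {P : Measure Ω}
    {z : ℕ → ℤ → Ω → ℝ} {V : ℕ → ℝ} (hV : ∀ i, 0 ≤ V i) {c : ℕ → ℝ} (hc : ∀ r, 0 ≤ c r)
    (hcov : ∀ (r u v : ℕ) (i : Fin u → ℕ) (j : Fin v → ℕ)
      (t : Fin u → ℤ) (t' : Fin v → ℤ), Monotone i → Monotone j → (∀ a b, i a + r < j b) →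
      ∀ f ∈ Delta1 u, ∀ g ∈ Delta1 v,
        |cov[fun ω => f (fun m => z (i m) (t m) ω), fun ω => g (fun m => z (j m) (t' m) ω); P]| ≤
          lambdaPsi (∑ m, V (i m)) (∑ m, V (j m)) (lip f) (lip g) * c r)
    (I : Finset ℤ) (a : ℤ → ℝ) {A : ℕ → ℝ}
    (hA : ∀ i, (∑ t ∈ I, |a t|) * (I.card * V (i + 1)) ≤ A i) {lam : ℕ → ℝ}
    (hlam : ∀ r, c r ≤ lam r) :
    IsBlockWeaklyDependent P (fun i ω => ∑ t ∈ I, a t * z (i + 1) t ω) A lam := by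
  intro r B B' hB f g K K' hf1 hg1 hK hK' hf hg
  set L := ∑ t ∈ I, |a t| with hLdef
  have hL : 0 ≤ L := Finset.sum_nonneg fun t _ => abs_nonneg _
  have haL : ∀ t ∈ I, |a t| ≤ L := fun t ht =>
    Finset.single_le_sum (f := fun t => |a t|) (fun t _ => abs_nonneg _) ht
  obtain ⟨u, i, t, hi, hiB, htI, hsum⟩ := exists_monotone_enumeration B I
  obtain ⟨v, j, t', hj, hjB, htI', hsum'⟩ := exists_monotone_enumeration B' I
  have lF := hasLipConst_comp_sum (c := fun m => a (t m)) (fun m => haL _ (htI m)) hL hK hf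
  have lG := hasLipConst_comp_sum (c := fun m => a (t' m)) (fun m => haL _ (htI' m)) hL hK' hg
  have key := hcov r u v (fun m => i m + 1) (fun m => j m + 1) t t'
    (fun m m' h => Nat.succ_le_succ (hi h)) (fun m m' h => Nat.succ_le_succ (hj h))
    (fun m m' => by have := hB _ (hiB m) _ (hjB m'); omega)
    _ ⟨⟨_, lF⟩, fun z => hf1 _⟩ _ ⟨⟨_, lG⟩, fun z => hg1 _⟩
  have e1 : ∀ ω, ∑ m, a (t m) * z (i m + 1) (t m) ω = ∑ b ∈ B, ∑ t ∈ I, a t * z (b + 1) t ω :=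
    fun ω => hsum fun b t => a t * z (b + 1) t ω
  have e2 : ∀ ω, ∑ m, a (t' m) * z (j m + 1) (t' m) ω =
      ∑ b ∈ B', ∑ t ∈ I, a t * z (b + 1) t ω :=
    fun ω => hsum' fun b t => a t * z (b + 1) t ω
  have d1 : ∑ m, V (i m + 1) = ∑ b ∈ B, I.card * V (b + 1) := by
    rw [hsum fun b _ => V (b + 1)]; simp
  have d2 : ∑ m, V (j m + 1) = ∑ b ∈ B', I.card * V (b + 1) := by
    rw [hsum' fun b _ => V (b + 1)]; simp
  simp only [e1, e2, d1, d2] at key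
  refine key.trans ?_
  have n1 : ∀ B : Finset ℕ, 0 ≤ ∑ b ∈ B, I.card * V (b + 1) := fun B =>
    Finset.sum_nonneg fun b _ => mul_nonneg (Nat.cast_nonneg _) (hV _)
  have hAB : ∀ B : Finset ℕ, L * ∑ b ∈ B, I.card * V (b + 1) ≤ ∑ b ∈ B, A b := fun B => by
    rw [Finset.mul_sum]
    exact Finset.sum_le_sum fun b _ => hA b
  have h1 := lambdaPsi_le (n1 B) (n1 B') (lip_nonneg _) (lip_nonneg _) le_rfl le_rfl lF.lip_le
    lG.lip_le
  have e3 : lambdaPsi (∑ b ∈ B, I.card * V (b + 1)) (∑ b ∈ B', I.card * V (b + 1))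
      (K * L) (K' * L) = lambdaPsi (L * ∑ b ∈ B, I.card * V (b + 1))
      (L * ∑ b ∈ B', I.card * V (b + 1)) K K' := by
    unfold lambdaPsi; ring
  have h2 := lambdaPsi_le (mul_nonneg hL (n1 B)) (mul_nonneg hL (n1 B')) hK hK' (hAB B) (hAB B')
    le_rfl le_rfl
  have h3 : 0 ≤ lambdaPsi (∑ b ∈ B, A b) (∑ b ∈ B', A b) K K' := by
    have p1 := (mul_nonneg hL (n1 B)).trans (hAB B)
    have p2 := (mul_nonneg hL (n1 B')).trans (hAB B')
    unfold lambdaPsi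
    positivity
  exact mul_le_mul (h1.trans (e3.trans_le h2)) (hlam r) (hc r) h3

lemma exists_forall_le_rpow {c : ℕ → ℝ} {ℓ : ℝ} (hℓ : 0 < ℓ)
    (h : c =O[atTop] (fun r : ℕ => (r : ℝ) ^ (-ℓ))) :
    ∃ C, 1 ≤ C ∧ ∀ r, c r ≤ C * ((r : ℝ) + 1) ^ (-ℓ) := by
  have h1 : (fun r : ℕ => (r : ℝ) ^ (-ℓ)) =O[atTop] (fun r : ℕ => ((r : ℝ) + 1) ^ (-ℓ)) := by
    refine IsBigO.of_bound (2 ^ ℓ) ?_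
    filter_upwards [eventually_ge_atTop 1] with r hr
    have hr' : (1 : ℝ) ≤ r := by exact_mod_cast hr
    have hpos : (0 : ℝ) ≤ r + 1 := by linarith
    rw [Real.norm_of_nonneg (Real.rpow_nonneg (Nat.cast_nonneg r) _),
      Real.norm_of_nonneg (Real.rpow_nonneg hpos _)]
    have e : (2 : ℝ) ^ ℓ * ((r : ℝ) + 1) ^ (-ℓ) = (((r : ℝ) + 1) / 2) ^ (-ℓ) := by
      rw [Real.div_rpow hpos (by norm_num), Real.rpow_neg (by norm_num : (0 : ℝ) ≤ 2), div_inv_eq_mul,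
        mul_comm]
    rw [e]
    exact Real.rpow_le_rpow_of_nonpos (by linarith) (by linarith) (by linarith)
  obtain ⟨C, hC⟩ := (isBigO_nat_atTop_iff fun r hr =>
    absurd hr (Real.rpow_pos_of_pos (by positivity) _).ne').1 (h.trans h1)
  refine ⟨max C 1, le_max_right _ _, fun r => (le_abs_self _).trans ((hC r).trans ?_)⟩
  have hp : (0 : ℝ) ≤ ((r : ℝ) + 1) ^ (-ℓ) := Real.rpow_nonneg (by positivity) _
  rw [Real.norm_of_nonneg hp]
  exact mul_le_mul_of_nonneg_right (le_max_left _ _) hp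

/-! ### The random environment -/

lemma HasUniformAverages.const_mul {A : ℕ → ℝ} (h : HasUniformAverages A) (D : ℝ) :
    HasUniformAverages fun i => D * A i := by
  intro c R h0 hR hc
  have := (h c R h0 hR hc).const_mul D
  rw [mul_zero] at this
  refine this.congr fun N => ?_
  rw [← mul_div_assoc, Finset.mul_sum]
  congr 1
  exact Finset.sum_congr rfl fun i _ => by ring

section Environment

variable {s : ℕ} {μ : Measure (Fin s → ℝ)} [IsProbabilityMeasure μ]

instance : IsProbabilityMeasure (envLaw μ) := by unfold envLaw; infer_instance

lemma measurePreserving_eval_envLaw (i : ℕ) :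
    MeasurePreserving (fun Y : ℕ → Fin s → ℝ => Y i) (envLaw μ) μ :=
  measurePreserving_eval_infinitePi (fun _ => μ) i

lemma ae_envLaw_of_ae {p : (Fin s → ℝ) → Prop} (h : ∀ᵐ y ∂μ, p y) (i : ℕ) :
    ∀ᵐ Y ∂(envLaw μ), p (Y i) :=
  (measurePreserving_eval_envLaw i).quasiMeasurePreserving.ae h

/-- Strong law of large numbers along the environment of the individuals `1, 2, …`. -/
lemma ae_tendsto_average {f : (Fin s → ℝ) → ℝ} (hf : Measurable f) (hint : Integrable f μ) :
    ∀ᵐ Y ∂(envLaw μ), Tendsto (fun N : ℕ => (∑ i ∈ Finset.range N, f (Y (i + 1))) / N) atTop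
      (𝓝 (∫ y, f y ∂μ)) := by
  have hmp : ∀ i, MeasurePreserving (fun Y : ℕ → Fin s → ℝ => Y i) (envLaw μ) μ :=
    measurePreserving_eval_envLaw
  have hind : iIndepFun (fun (i : ℕ) (Y : ℕ → Fin s → ℝ) => f (Y i)) (envLaw μ) :=
    iIndepFun_infinitePi fun _ => hf
  have := strong_law_ae_real (μ := envLaw μ) (fun i Y => f (Y (i + 1)))
    ((hmp 1).integrable_comp_of_integrable hint)
    (fun i j hij => hind.indepFun (by omega)) (fun i =>
      { aemeasurable_fst := (hf.comp (hmp (i + 1)).measurable).aemeasurable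
        aemeasurable_snd := (hf.comp (hmp 1).measurable).aemeasurable
        map_eq := by
          have h : ∀ j, (envLaw μ).map (fun Y => f (Y j)) = μ.map f := fun j => by
            conv_rhs => rw [← (hmp j).map_eq]
            exact (Measure.map_map hf (hmp j).measurable).symm
          rw [h (i + 1), h (0 + 1)] })
  have e : ∫ Y, f (Y (0 + 1)) ∂(envLaw μ) = ∫ y, f y ∂μ := by
    conv_rhs => rw [← (hmp 1).map_eq]
    exact (integral_map (hmp 1).measurable.aemeasurable hf.aestronglyMeasurable).symm
  rwa [e] at this

lemma ae_hasUniformAverages {f : (Fin s → ℝ) → ℝ} (hf : Measurable f) (hint : Integrable f μ)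
    (h0 : ∀ y, 0 ≤ f y) :
    ∀ᵐ Y ∂(envLaw μ), HasUniformAverages (fun i => f (Y (i + 1))) ∧
      ∃ M, ∀ N : ℕ, ∑ i ∈ Finset.range N, f (Y (i + 1)) ≤ M * N := by
  -- the excess of `f` over a large level has a small mean
  set g : ℕ → (Fin s → ℝ) → ℝ := fun K y => max (f y - K) 0 with hg
  have hgm : ∀ K, Measurable (g K) := fun K => (hf.sub_const _).max measurable_const
  have hg0 : ∀ K y, 0 ≤ g K y := fun K y => le_max_right _ _
  have hgf : ∀ K y, g K y ≤ f y := fun K y =>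
    max_le (by linarith [(Nat.cast_nonneg K : (0 : ℝ) ≤ K)]) (h0 y)
  have hgi : ∀ K, Integrable (g K) μ := fun K => hint.mono' (hgm K).aestronglyMeasurable
    (Eventually.of_forall fun y => by rw [Real.norm_of_nonneg (hg0 K y)]; exact hgf K y)
  have hglim : Tendsto (fun K => ∫ y, g K y ∂μ) atTop (𝓝 0) := by
    have := tendsto_integral_of_dominated_convergence (F := g) (f := fun _ => (0 : ℝ)) (μ := μ) f
      (fun K => (hgm K).aestronglyMeasurable) hint
      (fun K => Eventually.of_forall fun y => by
        rw [Real.norm_of_nonneg (hg0 K y)]; exact hgf K y)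
      (Eventually.of_forall fun y => by
        obtain ⟨K₀, hK₀⟩ := exists_nat_ge (f y)
        refine tendsto_const_nhds.congr' ?_
        filter_upwards [eventually_ge_atTop K₀] with K hK
        have : (K₀ : ℝ) ≤ K := by exact_mod_cast hK
        exact (max_eq_right (by linarith)).symm)
    simpa using this
  filter_upwards [ae_tendsto_average hf hint,
    ae_all_iff.2 fun K => ae_tendsto_average (hgm K) (hgi K)] with Y hY hYK
  constructor
  · intro c R hc0 hcR hc
    have hR : 0 ≤ R := (hc0 0 0).trans (hcR 0 0)
    rw [Metric.tendsto_nhds]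
    intro e he
    have h1 : Tendsto (fun K => R * ∫ y, g K y ∂μ) atTop (𝓝 0) := by
      simpa using hglim.const_mul R
    obtain ⟨K, hK⟩ := (h1.eventually (gt_mem_nhds he)).exists
    have h2 : Tendsto (fun N : ℕ => K * ((∑ i ∈ Finset.range N, c N i) / N) +
        R * ((∑ i ∈ Finset.range N, g K (Y (i + 1))) / N)) atTop
        (𝓝 (K * 0 + R * ∫ y, g K y ∂μ)) := (hc.const_mul _).add ((hYK K).const_mul R)
    have h3 : (K : ℝ) * 0 + R * ∫ y, g K y ∂μ < e := by simpa using hK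
    filter_upwards [h2.eventually (gt_mem_nhds h3)] with N hN
    have hnn : 0 ≤ (∑ i ∈ Finset.range N, c N i * f (Y (i + 1))) / (N : ℝ) :=
      div_nonneg (Finset.sum_nonneg fun i _ => mul_nonneg (hc0 N i) (h0 _)) (Nat.cast_nonneg N)
    rw [Real.dist_eq, sub_zero, abs_of_nonneg hnn]
    refine lt_of_le_of_lt ?_ hN
    rw [← mul_div_assoc, ← mul_div_assoc, ← add_div, Finset.mul_sum, Finset.mul_sum,
      ← Finset.sum_add_distrib]
    refine div_le_div_of_nonneg_right (Finset.sum_le_sum fun i _ => ?_) (Nat.cast_nonneg N)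
    have a1 : f (Y (i + 1)) ≤ K + g K (Y (i + 1)) := by
      have : f (Y (i + 1)) - K ≤ g K (Y (i + 1)) := le_max_left _ _
      linarith
    have a2 := mul_le_mul_of_nonneg_left a1 (hc0 N i)
    have a3 := mul_le_mul_of_nonneg_right (hcR N i) (hg0 K (Y (i + 1)))
    nlinarith
  · obtain ⟨M, hM⟩ := hY.bddAbove_range
    refine ⟨M, fun N => ?_⟩
    rcases Nat.eq_zero_or_pos N with rfl | hN
    · simp
    · have := hM ⟨N, rfl⟩
      rwa [div_le_iff₀ (Nat.cast_pos.2 hN)] at this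

variable {Ω' : Type*} [MeasurableSpace Ω'] {P' : Measure Ω'}
  {ε : ℕ → ℤ → Ω' → ℝ} {Z : ℤ → (Fin s → ℝ) → (ℤ → ℝ) → ℝ}

/-- All individuals have innovations of the same law on `ℤ → ℝ`. -/
lemma IsInnovationArray.map_eq [IsProbabilityMeasure P'] (hε : IsInnovationArray P' ε) (i : ℕ) :
    P'.map (fun ω k => ε i k ω) = P'.map (fun ω k => ε 0 k ω) := by
  have hone : ∀ i k, P'.map (ε i k) = P'.map (ε 0 k) := by
    intro i k
    induction i with
    | zero => rfl
    | succ i ih =>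
      rw [← ih]
      have h := congrArg (fun m : Measure (ℕ → ℝ) => m.map (fun x => x i)) (hε.stationary k)
      rw [Measure.map_map (measurable_pi_apply i)
          (measurable_pi_lambda _ fun j => hε.measurable (j + 1) k),
        Measure.map_map (measurable_pi_apply i)
          (measurable_pi_lambda _ fun j => hε.measurable j k)] at h
      exact h
  rw [(iIndepFun_iff_map_fun_eq_infinitePi_map (hε.measurable i)).1 (hε.indep i),
    (iIndepFun_iff_map_fun_eq_infinitePi_map (hε.measurable 0)).1 (hε.indep 0)]
  simp_rw [hone i]

lemma measurable_elem_uncurry (hε : IsInnovationArray P' ε)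
    (hZ : ∀ t, Measurable (fun p : (Fin s → ℝ) × (ℤ → ℝ) => Z t p.1 p.2)) (i : ℕ) (t : ℤ) :
    Measurable fun p : (Fin s → ℝ) × Ω' => elem Z ε i t p.1 p.2 :=
  (hZ t).comp (measurable_fst.prodMk
    (measurable_pi_lambda _ fun k => (hε.measurable i k).comp measurable_snd))

lemma measurable_elem (hε : IsInnovationArray P' ε)
    (hZ : ∀ t, Measurable (fun p : (Fin s → ℝ) × (ℤ → ℝ) => Z t p.1 p.2)) (i : ℕ) (t : ℤ)
    (y : Fin s → ℝ) : Measurable (elem Z ε i t y) :=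
  (measurable_elem_uncurry hε hZ i t).comp measurable_prodMk_left

lemma measurable_aggregation (hε : IsInnovationArray P' ε)
    (hZ : ∀ t, Measurable (fun p : (Fin s → ℝ) × (ℤ → ℝ) => Z t p.1 p.2))
    (Y : ℕ → Fin s → ℝ) (N : ℕ) (t : ℤ) : Measurable (aggregation Z ε Y N t) :=
  (Finset.measurable_sum _ fun i _ => measurable_elem hε hZ i t (Y i)).const_mul _

lemma integral_rpow_elem_eq [IsProbabilityMeasure P'] (hε : IsInnovationArray P' ε)
    (hZ : ∀ t, Measurable (fun p : (Fin s → ℝ) × (ℤ → ℝ) => Z t p.1 p.2)) (i : ℕ) (t : ℤ)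
    (y : Fin s → ℝ) (x : ℝ) :
    ∫ ω, |elem Z ε i t y ω| ^ x ∂P' = ∫ ω, |elem Z ε 0 t y ω| ^ x ∂P' := by
  have hm : Measurable fun e : ℤ → ℝ => |Z t y e| ^ x :=
    (measurable_norm.comp ((hZ t).comp measurable_prodMk_left)).pow_const _
  have h : ∀ i, ∫ ω, |elem Z ε i t y ω| ^ x ∂P' =
      ∫ e, |Z t y e| ^ x ∂(P'.map (fun ω k => ε i k ω)) := fun i => by
    rw [integral_map (measurable_pi_lambda _ fun k => hε.measurable i k).aemeasurable
      hm.aestronglyMeasurable]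
    rfl
  rw [h i, h 0, hε.map_eq i]

end Environment

/-! ### Convergence of characteristic functions in a regular environment -/

lemma inv_sqrt_mul_sum_eq_sum_aggregation {s : ℕ} {Ω' : Type*} {ε : ℕ → ℤ → Ω' → ℝ}
    {Z : ℤ → (Fin s → ℝ) → (ℤ → ℝ) → ℝ} (Y : ℕ → Fin s → ℝ) (I : Finset ℤ) (a : ℤ → ℝ)
    (N : ℕ) (ω : Ω') :
    (√N)⁻¹ * ∑ i ∈ Finset.range N, ∑ t ∈ I, a t * elem Z ε (i + 1) t (Y (i + 1)) ω =
      ∑ t ∈ I, a t * aggregation Z ε Y N t ω := by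
  rw [Finset.sum_comm, Finset.mul_sum]
  refine Finset.sum_congr rfl fun t _ => ?_
  have e : Finset.Icc 1 N = Finset.Ico (0 + 1) (N + 1) := rfl
  rw [aggregation, e, ← Finset.sum_Ico_add' (fun i => elem Z ε i t (Y i) ω) 0 N 1,
    ← Finset.range_eq_Ico, ← Finset.mul_sum]
  ring

section

variable {s : ℕ} {Ω' : Type*} [MeasurableSpace Ω'] {P' : Measure Ω'} [IsProbabilityMeasure P']
  {μ : Measure (Fin s → ℝ)} [IsProbabilityMeasure μ]
  {ε : ℕ → ℤ → Ω' → ℝ} {Z : ℤ → (Fin s → ℝ) → (ℤ → ℝ) → ℝ}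
  {δ ℓ : ℝ} {Γ : ℤ → ℝ} {V : (Fin s → ℝ) → ℝ} {lam : (ℕ → Fin s → ℝ) → ℕ → ℝ}

/-- Control function of the sums over the times of `I`: it dominates the moments of order `2 + δ`
and the control function `V`. By equality in law of the innovations, the moments can be computed
with the individual `0`. -/
noncomputable def control (P' : Measure Ω') (Z : ℤ → (Fin s → ℝ) → (ℤ → ℝ) → ℝ)
    (ε : ℕ → ℤ → Ω' → ℝ) (δ : ℝ) (V : (Fin s → ℝ) → ℝ) (I : Finset ℤ) (y : Fin s → ℝ) : ℝ :=
  1 + V y + ∑ t ∈ I, ∫ ω, |elem Z ε 0 t y ω| ^ (2 + δ) ∂P'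

/-- The environments along which the central limit theorem holds. -/
structure IsRegularEnvironment (P' : Measure Ω') (Z : ℤ → (Fin s → ℝ) → (ℤ → ℝ) → ℝ)
    (ε : ℕ → ℤ → Ω' → ℝ) (δ ℓ : ℝ) (Γ : ℤ → ℝ) (V : (Fin s → ℝ) → ℝ) (c : ℕ → ℝ)
    (Y : ℕ → Fin s → ℝ) : Prop where
  integral_eq_zero : ∀ i t, ∫ ω, elem Z ε i t (Y i) ω ∂P' = 0
  integrable_rpow : ∀ i t, Integrable (fun ω => |elem Z ε i t (Y i) ω| ^ (2 + δ)) P'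
  tendsto_cov : ∀ t τ, Tendsto (fun N : ℕ =>
    cov[aggregation Z ε Y N t, aggregation Z ε Y N (t + τ); P']) atTop (𝓝 (Γ τ))
  coeff_nonneg : ∀ r, 0 ≤ c r
  coeff_le : ∃ C, 1 ≤ C ∧ ∀ r, c r ≤ C * ((r : ℝ) + 1) ^ (-ℓ)
  cov_le : ∀ (r u v : ℕ) (i : Fin u → ℕ) (j : Fin v → ℕ)
    (t : Fin u → ℤ) (t' : Fin v → ℤ), Monotone i → Monotone j → (∀ a b, i a + r < j b) →
    ∀ f ∈ Delta1 u, ∀ g ∈ Delta1 v,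
      |cov[fun ω => f (fun m => elem Z ε (i m) (t m) (Y (i m)) ω),
          fun ω => g (fun m => elem Z ε (j m) (t' m) (Y (j m)) ω); P']| ≤
        lambdaPsi (∑ m, V (Y (i m))) (∑ m, V (Y (j m))) (lip f) (lip g) * c r
  averages : ∀ I : Finset ℤ, HasUniformAverages (fun i => control P' Z ε δ V I (Y (i + 1))) ∧
    ∃ M, ∀ N : ℕ, ∑ i ∈ Finset.range N, control P' Z ε δ V I (Y (i + 1)) ≤ M * N

lemma ae_isRegularEnvironment (hε : IsInnovationArray P' ε)
    (hZ : ∀ t, Measurable (fun p : (Fin s → ℝ) × (ℤ → ℝ) => Z t p.1 p.2))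
    (hcent : ∀ i t, ∀ᵐ y ∂μ, ∫ ω, elem Z ε i t y ω ∂P' = 0)
    (hK2 : ∀ i t, Integrable (fun p : (Fin s → ℝ) × Ω' => |elem Z ε i t p.1 p.2| ^ (2 + δ))
      (μ.prod P'))
    (hK4 : ∀ t τ, ∀ᵐ Y ∂(envLaw μ), Tendsto (fun N : ℕ =>
      cov[aggregation Z ε Y N t, aggregation Z ε Y N (t + τ); P']) atTop (𝓝 (Γ τ)))
    (hK5 : Integrable V μ) (hdep : IsLambdaWeaklyDependent P' μ Z ε V lam) (hℓ : 0 < ℓ)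
    (hrate : ∀ᵐ Y ∂(envLaw μ), lam Y =O[atTop] (fun r : ℕ => (r : ℝ) ^ (-ℓ))) :
    ∀ᵐ Y ∂(envLaw μ), IsRegularEnvironment P' Z ε δ ℓ Γ V (lam Y) Y := by
  have hmom0 : ∀ t y, 0 ≤ ∫ ω, |elem Z ε 0 t y ω| ^ (2 + δ) ∂P' := fun t y =>
    integral_nonneg fun ω => Real.rpow_nonneg (abs_nonneg _) _
  have hm : ∀ t, Measurable fun y => ∫ ω, |elem Z ε 0 t y ω| ^ (2 + δ) ∂P' := fun t => by
    have h1 : Measurable fun p : (Fin s → ℝ) × Ω' => |elem Z ε 0 t p.1 p.2| ^ (2 + δ) :=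
      (measurable_norm.comp (measurable_elem_uncurry hε hZ 0 t)).pow_const _
    exact h1.stronglyMeasurable.integral_prod_right.measurable
  have hcm : ∀ I, Measurable (control P' Z ε δ V I) := fun I =>
    (measurable_const.add hdep.measurable_V).add (Finset.measurable_sum _ fun t _ => hm t)
  have hci : ∀ I, Integrable (control P' Z ε δ V I) μ := fun I =>
    ((integrable_const _).add hK5).add (integrable_finsetSum _ fun t _ =>
      (hK2 0 t).integral_prod_left)
  have hc0 : ∀ I y, 0 ≤ control P' Z ε δ V I y := fun I y =>
    add_nonneg (add_nonneg zero_le_one (hdep.V_nonneg y)) (Finset.sum_nonneg fun t _ => hmom0 t y)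
  filter_upwards [ae_all_iff.2 fun i => ae_all_iff.2 fun t => ae_envLaw_of_ae (hcent i t) i,
    ae_all_iff.2 fun i => ae_all_iff.2 fun t => ae_envLaw_of_ae (hK2 i t).prod_right_ae i,
    ae_all_iff.2 fun t => ae_all_iff.2 fun τ => hK4 t τ, hdep.coeff_antitone, hdep.coeff_tendsto,
    hdep.cov_le, hrate, ae_all_iff.2 fun I => ae_hasUniformAverages (hcm I) (hci I) (hc0 I)]
    with Y h1 h2 h3 h4 h5 h6 h7 h8
  exact ⟨h1, h2, h3, fun r => h4.le_of_tendsto h5 r, exists_forall_le_rpow hℓ h7, h6, h8⟩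

/-- Quadratic form, at the coefficients `a` indexed by `I`, of the stationary covariance `Γ`. -/
def covForm (Γ : ℤ → ℝ) (I : Finset ℤ) (a : ℤ → ℝ) : ℝ :=
  ∑ t ∈ I, ∑ t' ∈ I, a t * a t' * Γ (t' - t)

namespace IsRegularEnvironment

variable {Y : ℕ → Fin s → ℝ} {c : ℕ → ℝ}

lemma memLp_aggregation (hY : IsRegularEnvironment P' Z ε δ ℓ Γ V c Y)
    (hε : IsInnovationArray P' ε)
    (hZ : ∀ t, Measurable (fun p : (Fin s → ℝ) × (ℤ → ℝ) => Z t p.1 p.2)) (hδ : 0 < δ)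
    (N : ℕ) (t : ℤ) : MemLp (aggregation Z ε Y N t) 2 P' :=
  memLp_const_mul_sum (W := fun i => elem Z ε i t (Y i)) (fun i =>
    memLp_two_of_integrable_rpow hδ (measurable_elem hε hZ i t (Y i)) (hY.integrable_rpow i t)) _ _

lemma integral_aggregation (hY : IsRegularEnvironment P' Z ε δ ℓ Γ V c Y)
    (hε : IsInnovationArray P' ε)
    (hZ : ∀ t, Measurable (fun p : (Fin s → ℝ) × (ℤ → ℝ) => Z t p.1 p.2)) (hδ : 0 < δ)
    (N : ℕ) (t : ℤ) : ∫ ω, aggregation Z ε Y N t ω ∂P' = 0 := by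
  simp only [aggregation]
  rw [integral_const_mul, integral_finsetSum _ fun i _ => integrable_of_integrable_rpow hδ
    (measurable_elem hε hZ i t (Y i)) (hY.integrable_rpow i t)]
  simp [hY.integral_eq_zero]

lemma tendsto_integral_sq (hY : IsRegularEnvironment P' Z ε δ ℓ Γ V c Y)
    (hε : IsInnovationArray P' ε)
    (hZ : ∀ t, Measurable (fun p : (Fin s → ℝ) × (ℤ → ℝ) => Z t p.1 p.2)) (hδ : 0 < δ)
    (I : Finset ℤ) (a : ℤ → ℝ) :
    Tendsto (fun N : ℕ => ∫ ω, (∑ t ∈ I, a t * aggregation Z ε Y N t ω) ^ 2 ∂P') atTop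
      (𝓝 (covForm Γ I a)) := by
  have h : ∀ N t t', ∫ ω, (a t * aggregation Z ε Y N t ω) * (a t' * aggregation Z ε Y N t' ω) ∂P' =
      a t * a t' * cov[aggregation Z ε Y N t, aggregation Z ε Y N (t + (t' - t)); P'] := by
    intro N t t'
    rw [add_sub_cancel, covariance, hY.integral_aggregation hε hZ hδ N t,
      hY.integral_aggregation hε hZ hδ N t', ← integral_const_mul]
    refine integral_congr_ae (Eventually.of_forall fun ω => ?_)
    simp only [sub_zero]
    ring
  refine Tendsto.congr (fun N => (integral_sq_sum_eq (fun t =>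
    (hY.memLp_aggregation hε hZ hδ N t).const_mul (a t)) I).symm) ?_
  simp_rw [h]
  exact tendsto_finsetSum _ fun t _ => tendsto_finsetSum _ fun t' _ =>
    (hY.tendsto_cov t (t' - t)).const_mul _

/-- The characteristic functions of the finite-dimensional distributions of the aggregation converge
to the Gaussian ones. -/
theorem tendsto_integral_exp (hY : IsRegularEnvironment P' Z ε δ ℓ Γ V c Y)
    (hε : IsInnovationArray P' ε)
    (hZ : ∀ t, Measurable (fun p : (Fin s → ℝ) × (ℤ → ℝ) => Z t p.1 p.2)) (hδ : 0 < δ)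
    (hℓ : 2 + 3 / δ < ℓ) (hV : ∀ y, 0 ≤ V y) (I : Finset ℤ) (a : ℤ → ℝ) :
    Tendsto (fun N : ℕ => ∫ ω, Complex.exp
      ((∑ t ∈ I, a t * aggregation Z ε Y N t ω : ℝ) * Complex.I) ∂P')
      atTop (𝓝 (Complex.exp (-(covForm Γ I a : ℂ) / 2))) := by
  obtain ⟨C, hC1, hC⟩ := hY.coeff_le
  obtain ⟨hunif, M, hM⟩ := hY.averages I
  set L := ∑ t ∈ I, |a t| with hLdef
  have hL : 0 ≤ L := Finset.sum_nonneg fun t _ => abs_nonneg _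
  have haL : ∀ t ∈ I, |a t| ≤ L := fun t ht =>
    Finset.single_le_sum (f := fun t => |a t|) (fun t _ => abs_nonneg _) ht
  set W : ℕ → Ω' → ℝ := fun i ω => ∑ t ∈ I, a t * elem Z ε (i + 1) t (Y (i + 1)) ω with hW
  set D := 1 + L * I.card + L ^ (2 + δ) with hD
  have hLδ : 0 ≤ L ^ (2 + δ) := Real.rpow_nonneg hL _
  have hLI : 0 ≤ L * I.card := mul_nonneg hL (Nat.cast_nonneg _)
  have hD1 : 1 ≤ D := by linarith
  set A : ℕ → ℝ := fun i => D * control P' Z ε δ V I (Y (i + 1)) with hA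
  have hmom0 : ∀ y, 0 ≤ ∑ t ∈ I, ∫ ω, |elem Z ε 0 t y ω| ^ (2 + δ) ∂P' := fun y =>
    Finset.sum_nonneg fun t _ => integral_nonneg fun ω => Real.rpow_nonneg (abs_nonneg _) _
  have hel : ∀ i t, Measurable (elem Z ε i t (Y i)) := fun i t => measurable_elem hε hZ i t (Y i)
  have hWm : ∀ i, Measurable (W i) := fun i =>
    Finset.measurable_sum _ fun t _ => (hel (i + 1) t).const_mul (a t)
  -- moments of the linear combinations, from `|∑ a_t z_t| ≤ L max |z_t|`
  have hpt : ∀ i ω, |W i ω| ^ (2 + δ) ≤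
      L ^ (2 + δ) * ∑ t ∈ I, |elem Z ε (i + 1) t (Y (i + 1)) ω| ^ (2 + δ) := by
    intro i ω
    rcases I.eq_empty_or_nonempty with hI | hI
    · simp [hW, hI, Real.zero_rpow (by linarith : (2 + δ) ≠ 0)]
    obtain ⟨t₀, ht₀, hmax⟩ := Finset.exists_max_image I
      (fun t => |elem Z ε (i + 1) t (Y (i + 1)) ω|) hI
    have h1 : |W i ω| ≤ L * |elem Z ε (i + 1) t₀ (Y (i + 1)) ω| := by
      rw [hLdef, Finset.sum_mul]
      refine (Finset.abs_sum_le_sum_abs _ _).trans (Finset.sum_le_sum fun t ht => ?_)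
      rw [abs_mul]
      exact mul_le_mul_of_nonneg_left (hmax t ht) (abs_nonneg _)
    refine (Real.rpow_le_rpow (abs_nonneg _) h1 (by linarith)).trans ?_
    rw [Real.mul_rpow hL (abs_nonneg _)]
    exact mul_le_mul_of_nonneg_left (Finset.single_le_sum
      (f := fun t => |elem Z ε (i + 1) t (Y (i + 1)) ω| ^ (2 + δ))
      (fun t _ => Real.rpow_nonneg (abs_nonneg _) _) ht₀) hLδ
  have hbi : ∀ i, Integrable (fun ω => L ^ (2 + δ) *
      ∑ t ∈ I, |elem Z ε (i + 1) t (Y (i + 1)) ω| ^ (2 + δ)) P' := fun i =>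
    (integrable_finsetSum _ fun t _ => hY.integrable_rpow (i + 1) t).const_mul _
  have hint : ∀ i, Integrable (fun ω => |W i ω| ^ (2 + δ)) P' := fun i =>
    (hbi i).mono' ((measurable_norm.comp (hWm i)).pow_const _).aestronglyMeasurable
      (Eventually.of_forall fun ω => by
        rw [Real.norm_of_nonneg (Real.rpow_nonneg (abs_nonneg _) _)]; exact hpt i ω)
  have hmom : ∀ i, ∫ ω, |W i ω| ^ (2 + δ) ∂P' ≤ A i := by
    intro i
    have h1 := integral_mono (hint i) (hbi i) (hpt i)
    rw [integral_const_mul, integral_finsetSum _ fun t _ => hY.integrable_rpow (i + 1) t] at h1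
    simp_rw [integral_rpow_elem_eq hε hZ (i + 1)] at h1
    refine h1.trans (mul_le_mul (by linarith) ?_ (hmom0 _) (by linarith))
    have := hV (Y (i + 1))
    rw [control]
    linarith
  have hc1 : ∀ i, 1 ≤ control P' Z ε δ V I (Y (i + 1)) := fun i => by
    have := hV (Y (i + 1))
    have := hmom0 (Y (i + 1))
    rw [control]
    linarith
  have hA1 : ∀ i, 1 ≤ A i := fun i => one_le_mul_of_one_le_of_one_le hD1 (hc1 i)
  have h0 : ∀ i, ∫ ω, W i ω ∂P' = 0 := fun i => by
    rw [hW, integral_finsetSum _ fun t _ => (integrable_of_integrable_rpow hδ (hel (i + 1) t)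
      (hY.integrable_rpow (i + 1) t)).const_mul (a t)]
    simp [integral_const_mul, hY.integral_eq_zero]
  have hdep : IsBlockWeaklyDependent P' W A fun r => C * ((r : ℝ) + 1) ^ (-ℓ) := by
    refine isBlockWeaklyDependent_of_cov_le (z := fun i t => elem Z ε i t (Y i))
      (V := fun i => V (Y i)) (fun i => hV _) hY.coeff_nonneg hY.cov_le I a (fun i => ?_) hC
    rw [← mul_assoc]
    refine mul_le_mul (by linarith) ?_ (hV _) (by linarith)
    have := hmom0 (Y (i + 1))
    rw [control]
    linarith
  have hAM : ∀ N : ℕ, ∑ i ∈ Finset.range N, A i ≤ D * M * N := fun N => by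
    rw [hA, ← Finset.mul_sum, mul_assoc]
    exact mul_le_mul_of_nonneg_left (hM N) (by linarith)
  have hv : Tendsto (fun N : ℕ => (∑ i ∈ Finset.range N, ∑ j ∈ Finset.range N,
      ∫ ω, W i ω * W j ω ∂P') / N) atTop (𝓝 (covForm Γ I a)) := by
    refine (hY.tendsto_integral_sq hε hZ hδ I a).congr fun N => ?_
    simp_rw [← inv_sqrt_mul_sum_eq_sum_aggregation, mul_pow]
    rw [integral_const_mul, integral_sq_sum_eq (W := W) (fun i =>
      memLp_two_of_integrable_rpow hδ (hWm i) (hint i)), inv_pow, Real.sq_sqrt (Nat.cast_nonneg N),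
      ← div_eq_inv_mul]
  have key := tendsto_integral_exp_of_polynomial_rate hδ hℓ hC1 hWm hA1 hint hmom h0 hdep hAM
    (hunif.const_mul D) hv
  simpa only [hW, inv_sqrt_mul_sum_eq_sum_aggregation] using key

end IsRegularEnvironment

end

/-! ### The Gaussian limit -/

/-- A set of measures on a countable product is tight as soon as its one-dimensional marginals are. -/
lemma isTightMeasureSet_pi {ι : Type*} [Countable ι] {S : Set (Measure (ι → ℝ))}
    (h : ∀ i, IsTightMeasureSet ((fun m : Measure (ι → ℝ) => m.map (fun x => x i)) '' S)) :
    IsTightMeasureSet S := by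
  rw [isTightMeasureSet_iff_exists_isCompact_measure_compl_le]
  intro e he
  obtain ⟨e', he', hsum⟩ := ENNReal.exists_pos_sum_of_countable' he.ne' ι
  have h' := fun i => isTightMeasureSet_iff_exists_isCompact_measure_compl_le.1 (h i) (e' i) (he' i)
  choose K hK hKm using h'
  refine ⟨Set.univ.pi K, isCompact_univ_pi hK, fun m hm => ?_⟩
  have hc : (Set.univ.pi K)ᶜ = ⋃ i, (fun x : ι → ℝ => x i) ⁻¹' (K i)ᶜ := by
    ext x; simp [Set.mem_pi]
  rw [hc]
  refine (measure_iUnion_le _).trans ((ENNReal.tsum_le_tsum fun i => ?_).trans hsum.le)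
  have := hKm i _ ⟨m, hm, rfl⟩
  rwa [Measure.map_apply (measurable_pi_apply i) (hK i).isClosed.measurableSet.compl] at this

/-- The linear forms of `x : ℤ → ℝ` given by `I` and `a` have, under `π`, the characteristic
functions of the centered Gaussian process with covariance `Γ`. -/
def HasGaussianCharFun (π : Measure (ℤ → ℝ)) (Γ : ℤ → ℝ) : Prop :=
  ∀ (I : Finset ℤ) (a : ℤ → ℝ),
    ∫ x, Complex.exp ((∑ t ∈ I, a t * x t : ℝ) * Complex.I) ∂π =
      Complex.exp (-(covForm Γ I a : ℂ) / 2)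

lemma measurable_sum_mul (I : Finset ℤ) (a : ℤ → ℝ) :
    Measurable fun x : ℤ → ℝ => ∑ t ∈ I, a t * x t :=
  Finset.measurable_sum _ fun t _ => (measurable_pi_apply t).const_mul _

/-- Existence of the limit process: the laws of the processes `X N` on `ℤ → ℝ` are tight, and every
limit point has the prescribed characteristic functions. -/
lemma exists_hasGaussianCharFun {Ω : Type*} [MeasurableSpace Ω] {P : Measure Ω}
    [IsProbabilityMeasure P] {X : ℕ → ℤ → Ω → ℝ} (hX : ∀ N t, Measurable (X N t)) {Γ : ℤ → ℝ}
    (h : ∀ (I : Finset ℤ) (a : ℤ → ℝ), Tendsto (fun N : ℕ => ∫ ω, Complex.exp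
      ((∑ t ∈ I, a t * X N t ω : ℝ) * Complex.I) ∂P)
      atTop (𝓝 (Complex.exp (-(covForm Γ I a : ℂ) / 2)))) :
    ∃ π : Measure (ℤ → ℝ), IsProbabilityMeasure π ∧ HasGaussianCharFun π Γ := by
  have hXm : ∀ N, Measurable fun ω t => X N t ω := fun N => measurable_pi_lambda _ (hX N)
  set m : ℕ → ProbabilityMeasure (ℤ → ℝ) := fun N =>
    ⟨P.map (fun ω t => X N t ω), Measure.isProbabilityMeasure_map (hXm N).aemeasurable⟩ with hm
  have htight : IsTightMeasureSet {ν : Measure (ℤ → ℝ) | ∃ ν' ∈ Set.range m, ↑ν' = ν} := by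
    refine isTightMeasureSet_pi fun t => ?_
    have hprob : ∀ N, IsProbabilityMeasure (P.map (X N t)) := fun N =>
      Measure.isProbabilityMeasure_map (hX N t).aemeasurable
    have := isTightMeasureSet_of_tendsto_charFun (E := ℝ) (μ := fun N => P.map (X N t))
      (f := fun ξ => Complex.exp (-(covForm Γ {t} (fun _ => ξ) : ℂ) / 2))
      (Continuous.continuousAt (by simp only [covForm, Finset.sum_singleton]; fun_prop))
      (fun ξ => by
        refine (h {t} fun _ => ξ).congr fun N => ?_
        rw [charFun_apply_real, integral_map (hX N t).aemeasurable
          (Measurable.aestronglyMeasurable (by fun_prop))]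
        simp)
    refine this.subset ?_
    rintro _ ⟨_, ⟨_, ⟨N, rfl⟩, rfl⟩, rfl⟩
    exact ⟨N, (Measure.map_map (measurable_pi_apply t) (hXm N)).symm⟩
  have hcomp : IsCompact (closure (Set.range m)) := isCompact_closure_of_isTightMeasureSet htight
  obtain ⟨π, -, hπ⟩ := hcomp.ultrafilter_le_nhds ((Ultrafilter.of atTop).map m)
    (le_principal_iff.2 (mem_of_superset (by simp) subset_closure))
  have hπ' : Tendsto m (Ultrafilter.of (atTop : Filter ℕ) : Filter ℕ) (𝓝 π) := hπ
  refine ⟨π, inferInstance, fun I a => ?_⟩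
  rw [ProbabilityMeasure.tendsto_iff_forall_integral_rclike_tendsto ℂ] at hπ'
  have hc : Continuous fun x : ℤ → ℝ =>
      Complex.exp ((∑ t ∈ I, a t * x t : ℝ) * Complex.I) := by fun_prop
  set f : BoundedContinuousFunction (ℤ → ℝ) ℂ := BoundedContinuousFunction.ofNormedAddCommGroup
    (fun x : ℤ → ℝ => Complex.exp ((∑ t ∈ I, a t * x t : ℝ) * Complex.I)) hc 1
    (fun x => (Complex.norm_exp_ofReal_mul_I _).le) with hf
  have h1 := hπ' f
  have h2 := (h I a).mono_left (Ultrafilter.of_le (atTop : Filter ℕ))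
  refine tendsto_nhds_unique h1 (h2.congr fun N => ?_)
  rw [hm, ProbabilityMeasure.coe_mk, integral_map (hXm N).aemeasurable
    f.continuous.measurable.aestronglyMeasurable]
  rfl

namespace HasGaussianCharFun

variable {π : Measure (ℤ → ℝ)} [IsProbabilityMeasure π] {Γ : ℤ → ℝ}

lemma covForm_nonneg (h : HasGaussianCharFun π Γ) (I : Finset ℤ) (a : ℤ → ℝ) :
    0 ≤ covForm Γ I a := by
  have h1 := norm_integral_exp_le_one (P := π) (fun x : ℤ → ℝ => ∑ t ∈ I, a t * x t)
  rw [h I a, Complex.norm_exp] at h1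
  have h2 : (-(covForm Γ I a : ℂ) / 2).re = -(covForm Γ I a) / 2 := by
    rw [← Complex.ofReal_neg, ← Complex.ofReal_ofNat, ← Complex.ofReal_div, Complex.ofReal_re]
  rw [h2, Real.exp_le_one_iff] at h1
  linarith

lemma hasLaw_sum (h : HasGaussianCharFun π Γ) (I : Finset ℤ) (a : ℤ → ℝ) :
    HasLaw (fun x : ℤ → ℝ => ∑ t ∈ I, a t * x t) (gaussianReal 0 (covForm Γ I a).toNNReal) π := by
  have hmeas := measurable_sum_mul I a
  refine ⟨hmeas.aemeasurable, ?_⟩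
  have := Measure.isProbabilityMeasure_map (μ := π) hmeas.aemeasurable
  refine Measure.ext_of_charFun (funext fun ξ => ?_)
  rw [charFun_gaussianReal, charFun_apply_real, integral_map hmeas.aemeasurable
    (Measurable.aestronglyMeasurable (by fun_prop))]
  have h1 := h I fun t => ξ * a t
  have e : covForm Γ I (fun t => ξ * a t) = ξ ^ 2 * covForm Γ I a := by
    simp only [covForm, Finset.mul_sum]
    exact Finset.sum_congr rfl fun t _ => Finset.sum_congr rfl fun t' _ => by ring
  simp_rw [mul_assoc ξ, ← Finset.mul_sum] at h1
  rw [e] at h1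
  have e2 : (((covForm Γ I a).toNNReal : ℝ) : ℂ) = covForm Γ I a := by
    rw [Real.coe_toNNReal _ (h.covForm_nonneg I a)]
  rw [e2]
  push_cast at h1 ⊢
  rw [h1]
  congr 1
  ring

lemma isGaussian_eval (h : HasGaussianCharFun π Γ) :
    IsGaussianProcess (fun (t : ℤ) (x : ℤ → ℝ) => x t) π := by
  refine ⟨fun I => ⟨isGaussian_of_map_eq_gaussianReal fun L => ?_⟩⟩
  set a : ℤ → ℝ := fun t => if ht : t ∈ I then L (Pi.single ⟨t, ht⟩ 1) else 0 with ha
  refine ⟨0, (covForm Γ I a).toNNReal, ?_⟩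
  have hr : Measurable fun x : ℤ → ℝ => I.restrict (fun t => x t) :=
    measurable_pi_lambda _ fun t => measurable_pi_apply _
  rw [Measure.map_map L.continuous.measurable hr, ← (h.hasLaw_sum I a).map_eq]
  congr 1
  funext x
  have e : I.restrict (fun t => x t) = ∑ t : I, x t • (Pi.single t 1 : I → ℝ) := by
    funext t
    simp [Finset.sum_apply, Pi.single_apply]
  simp only [Function.comp_apply]
  rw [e, map_sum, ← Finset.sum_coe_sort I]
  refine Finset.sum_congr rfl fun t _ => ?_
  rw [map_smul, smul_eq_mul, ha]
  simp [mul_comm]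

lemma integral_eq_zero (h : HasGaussianCharFun π Γ) (t : ℤ) : ∫ x, x t ∂π = 0 := by
  have := (h.hasLaw_sum {t} fun _ => 1).integral_eq
  simpa using this

lemma covariance_eq (h : HasGaussianCharFun π Γ) (hΓ : ∀ τ, Γ (-τ) = Γ τ) (t τ : ℤ) :
    cov[fun x : ℤ → ℝ => x t, fun x : ℤ → ℝ => x (t + τ); π] = Γ τ := by
  have hLp : ∀ t, MemLp (fun x : ℤ → ℝ => x t) 2 π := fun t => by
    have hg : HasGaussianLaw (fun x : ℤ → ℝ => x t) π := h.isGaussian_eval.hasGaussianLaw_eval t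
    exact hg.memLp_two
  have hvar : ∀ (I : Finset ℤ) (a : ℤ → ℝ),
      Var[fun x : ℤ → ℝ => ∑ t ∈ I, a t * x t; π] = covForm Γ I a := fun I a => by
    rw [(h.hasLaw_sum I a).variance_eq, variance_id_gaussianReal,
      Real.coe_toNNReal _ (h.covForm_nonneg I a)]
  have hone : ∀ t, Var[fun x : ℤ → ℝ => x t; π] = Γ 0 := fun t => by
    have := hvar {t} fun _ => 1
    simpa [covForm] using this
  -- polarization
  set a : ℤ → ℝ := fun u => (if u = t then 1 else 0) + (if u = t + τ then 1 else 0) with ha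
  have hsum : ∀ x : ℤ → ℝ, ∑ u ∈ ({t, t + τ} : Finset ℤ), a u * x u = x t + x (t + τ) := by
    intro x
    simp only [ha, add_mul, Finset.sum_add_distrib, ite_mul, one_mul, zero_mul]
    rw [Finset.sum_ite_eq', Finset.sum_ite_eq']
    simp
  have hform : covForm Γ {t, t + τ} a = 2 * Γ 0 + 2 * Γ τ := by
    have h1 : ∀ u, ∑ u' ∈ ({t, t + τ} : Finset ℤ), a u * a u' * Γ (u' - u) =
        a u * (Γ (t - u) + Γ (t + τ - u)) := fun u => by
      rw [← hsum fun u' => Γ (u' - u), Finset.mul_sum]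
      exact Finset.sum_congr rfl fun u' _ => by ring
    rw [covForm, Finset.sum_congr rfl fun u _ => h1 u,
      hsum fun u => Γ (t - u) + Γ (t + τ - u)]
    have e1 : t - (t + τ) = -τ := by ring
    have e2 : t + τ - t = τ := by ring
    simp only [sub_self, e1, e2, hΓ]
    ring
  have h2 := hvar {t, t + τ} a
  simp_rw [hsum] at h2
  rw [variance_fun_add (hLp t) (hLp (t + τ)), hone, hone, hform] at h2
  linarith

/-- By Lévy's theorem, convergence of the characteristic functions of all linear forms gives
convergence in distribution. -/
lemma tendstoInDistribution (h : HasGaussianCharFun π Γ) {Ω : Type*} [MeasurableSpace Ω]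
    {P : Measure Ω} [IsProbabilityMeasure P] {X : ℕ → ℤ → Ω → ℝ} (hX : ∀ N t, Measurable (X N t))
    (I : Finset ℤ)
    (hlim : ∀ a : ℤ → ℝ, Tendsto (fun N : ℕ => ∫ ω, Complex.exp
      ((∑ t ∈ I, a t * X N t ω : ℝ) * Complex.I) ∂P)
      atTop (𝓝 (Complex.exp (-(covForm Γ I a : ℂ) / 2)))) :
    TendstoInDistribution (fun (N : ℕ) (ω : Ω) (t : I) => X N t ω) atTop
      (fun (x : ℤ → ℝ) (t : I) => x t) (fun _ => P) π := by
  have hXm : ∀ N, Measurable fun ω => WithLp.toLp 2 (fun t : I => X N t ω) := fun N =>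
    (WithLp.measurable_toLp 2 _).comp (measurable_pi_lambda _ fun t => hX N t)
  have hxm : Measurable fun x : ℤ → ℝ => WithLp.toLp 2 (fun t : I => x t) :=
    (WithLp.measurable_toLp 2 _).comp (measurable_pi_lambda _ fun t => measurable_pi_apply _)
  have key : TendstoInDistribution
      (fun (N : ℕ) (ω : Ω) => (WithLp.toLp 2 (fun t : I => X N t ω) : EuclideanSpace ℝ I)) atTop
      (fun x : ℤ → ℝ => (WithLp.toLp 2 (fun t : I => x t) : EuclideanSpace ℝ I))
      (fun _ => P) π := by
    refine ⟨fun N => (hXm N).aemeasurable, hxm.aemeasurable, ?_⟩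
    refine ProbabilityMeasure.tendsto_of_tendsto_charFun fun ξ => ?_
    set a : ℤ → ℝ := fun t => if ht : t ∈ I then ξ ⟨t, ht⟩ else 0 with ha
    have hinner : ∀ y : ℤ → ℝ, inner ℝ (WithLp.toLp 2 (fun t : I => y t) : EuclideanSpace ℝ I) ξ =
        ∑ t ∈ I, a t * y t := fun y => by
      rw [PiLp.inner_apply, ← Finset.sum_coe_sort I]
      refine Finset.sum_congr rfl fun t _ => ?_
      simp [ha]
    have e : charFun (π.map fun x : ℤ → ℝ =>
        (WithLp.toLp 2 (fun t : I => x t) : EuclideanSpace ℝ I)) ξ =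
        Complex.exp (-(covForm Γ I a : ℂ) / 2) := by
      rw [charFun_apply, integral_map hxm.aemeasurable
        (Measurable.aestronglyMeasurable (by fun_prop)), ← h I a]
      simp_rw [hinner]
    simp only [ProbabilityMeasure.coe_mk]
    rw [e]
    refine (hlim a).congr fun N => ?_
    rw [charFun_apply, integral_map (hXm N).aemeasurable
      (Measurable.aestronglyMeasurable (by fun_prop))]
    refine integral_congr_ae (Eventually.of_forall fun ω => ?_)
    simp only
    rw [hinner fun t => X N t ω]
  exact key.continuous_comp (g := WithLp.ofLp) (PiLp.continuous_ofLp 2 _)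

end HasGaussianCharFun

end DoublyStochastic

theorem mainTheorem1 {s : ℕ} {Ω' : Type*} [MeasurableSpace Ω']
    (P' : Measure Ω') [IsProbabilityMeasure P']
    (μ : Measure (Fin s → ℝ)) [IsProbabilityMeasure μ]
    (ε : ℕ → ℤ → Ω' → ℝ) (hε : DoublyStochastic.IsInnovationArray P' ε)
    (Z : ℤ → (Fin s → ℝ) → (ℤ → ℝ) → ℝ)
    (hZ : ∀ t, Measurable (fun p : (Fin s → ℝ) × (ℤ → ℝ) => Z t p.1 p.2))
    -- conditionally centered
    (hcent : ∀ i t, ∀ᵐ y ∂μ, ∫ ω, DoublyStochastic.elem Z ε i t y ω ∂P' = 0)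
    -- moments of order `2 + δ`
    (δ : ℝ) (hδ : 0 < δ)
    (hK2 : ∀ i t, Integrable (fun p : (Fin s → ℝ) × Ω' =>
      |DoublyStochastic.elem Z ε i t p.1 p.2| ^ (2 + δ)) (μ.prod P'))
    -- convergence of the covariance function of the partial aggregation
    (Γ : ℤ → ℝ)
    (hK4 : ∀ t τ, ∀ᵐ Y ∂(DoublyStochastic.envLaw μ), Tendsto (fun N : ℕ =>
      cov[DoublyStochastic.aggregation Z ε Y N t,
        DoublyStochastic.aggregation Z ε Y N (t + τ); P']) atTop (𝓝 (Γ τ)))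
    -- weak dependence, with an integrable control function and polynomial rate
    (V : (Fin s → ℝ) → ℝ) (hK5 : Integrable V μ)
    (lam : (ℕ → Fin s → ℝ) → ℕ → ℝ)
    (hdep : DoublyStochastic.IsLambdaWeaklyDependent P' μ Z ε V lam)
    (ℓ : ℝ) (hℓ : 2 + 3 / δ < ℓ)
    (hrate : ∀ᵐ Y ∂(DoublyStochastic.envLaw μ),
      lam Y =O[atTop] (fun r : ℕ => (r : ℝ) ^ (-ℓ))) :
    ∃ (π : Measure (ℤ → ℝ)) (_ : IsProbabilityMeasure π),
      IsGaussianProcess (fun (t : ℤ) (x : ℤ → ℝ) => x t) π ∧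
      (∀ t : ℤ, ∫ x, x t ∂π = 0) ∧
      (∀ t τ : ℤ, cov[fun x : ℤ → ℝ => x t, fun x : ℤ → ℝ => x (t + τ); π] = Γ τ) ∧
      ∀ᵐ Y ∂(DoublyStochastic.envLaw μ), ∀ I : Finset ℤ,
        TendstoInDistribution
          (fun (N : ℕ) (ω : Ω') (t : I) => DoublyStochastic.aggregation Z ε Y N t ω) atTop
          (fun (x : ℤ → ℝ) (t : I) => x t) (fun _ => P') π := by
  have h3 : 0 < 3 / δ := by positivity
  have hreg := DoublyStochastic.ae_isRegularEnvironment hε hZ hcent hK2 hK4 hK5 hdep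
    (by linarith : 0 < ℓ) hrate
  have hlim : ∀ Y, DoublyStochastic.IsRegularEnvironment P' Z ε δ ℓ Γ V (lam Y) Y →
      ∀ I a, Tendsto (fun N : ℕ => ∫ ω, Complex.exp
        ((∑ t ∈ I, a t * DoublyStochastic.aggregation Z ε Y N t ω : ℝ) * Complex.I) ∂P')
        atTop (𝓝 (Complex.exp (-(DoublyStochastic.covForm Γ I a : ℂ) / 2))) := fun Y hY I a =>
    hY.tendsto_integral_exp hε hZ hδ hℓ hdep.V_nonneg I a
  have hmeas := DoublyStochastic.measurable_aggregation (P' := P') hε hZ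
  obtain ⟨Y₀, hY₀⟩ := hreg.exists
  obtain ⟨π, hπ, hG⟩ := DoublyStochastic.exists_hasGaussianCharFun (hmeas Y₀) (hlim Y₀ hY₀)
  have hΓ : ∀ τ, Γ (-τ) = Γ τ := fun τ => by
    refine tendsto_nhds_unique (hY₀.tendsto_cov τ (-τ)) ((hY₀.tendsto_cov 0 τ).congr fun N => ?_)
    rw [add_neg_cancel, zero_add, covariance_comm]
  refine ⟨π, hπ, hG.isGaussian_eval, hG.integral_eq_zero, hG.covariance_eq hΓ, ?_⟩
  filter_upwards [hreg] with Y hY I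
  exact hG.tendstoInDistribution (hmeas Y) I (hlim Y hY I)
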